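/- Let $\mathbb R^{1,4}$ be $\mathbb R^5$ with basis $\alpha_1,\dots,\alpha_5$ and the symmetric product of signature $(1,4)$ with Gram matrix $$J=[\alpha_i\cdot\alpha_j]=\begin{pmatrix}-2&1&0&0&0\\1&-2&1&0&1\\0&1&-2&1&0\\0&0&1&-2&\sqrt3\\0&1&0&\sqrt3&-2\end{pmatrix},$$ the Gram matrix of Maxwell's last $N=5$ Coxeter graph. Let $\Gamma$ be the group generated by the five reflections $x\mapsto x-2\frac{\alpha_i\cdot x}{\alpha_i\cdot\alpha_i}\alpha_i$, let $w_1,\dots,w_5$ be the weights ($w_i\cdot\alpha_j=\delta_{ij}$), and let $\mathcal P$ be the packing generated by the graph: the set of all vectors $\gamma(w_i)/\|\gamma(w_i)\|$ with $\gamma\in\Gamma$ and $w_i\cdot w_i<0$, where $\|n\|=\sqrt{-n\cdot n}$. Fix the time orientation given by a vector $D$ with $D\cdot D>0$ and $D\cdot\alpha_i\ge0$ for all $i$ (such $D$ exist). Let $\mathcal H=\{x: x\cdot x=1,\ x\cdot D>0\}$ be hyperbolic $4$-space, and let $\mathcal L^+=\{x: x\cdot x=0,\ x\cdot D>0\}$,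 whose rays are the points of $\partial\mathcal H\cong\mathbb R^3\cup\{\infty\}$. A vector $n$ with $n\cdot n<0$ represents the oriented sphere in $\partial\mathcal H$ that bounds the open ball $\{x\in\mathcal L^+: n\cdot x<0\}$; for a point at infinity $E\in\mathcal L^+$ its curvature is $n\cdot E/\|n\|$. Then the following hold. 1. $\mathcal P$ is an Apollonian sphere packing in $\mathbb R^3$, that is: - (packing) there is $k>0$ with $n\cdot n=-k$ and $n\cdot n'\ge k$ for all distinct $n,n'\in\mathcal P$, and the open balls bounded by distinct members of $\mathcal P$ are disjoint, so the spheres are tangent or do not meet; - (crystallographic, over $\mathbb Z[\sqrt3]$) there are a basis $b_1,\dots,b_5$ of $\mathbb R^5$ with $\mathbb Z[\sqrt3]$-lattice $\Lambda=\bigoplus_i\mathbb Z[\sqrt3]\,b_i$, a group $\Gamma'$ of isometries of $\mathcal H$ that map $\Lambda$ onto itself and that has a convex fundamental domain in $\mathcal H$ with finitely many faces, and a finite set $S\subset\Lambda$ of vectors of negative norm with $\mathcal P=\{\gamma(n)/\|\gamma(n)\|:\gamma\in\Gamma',\ n\in S\}$; - (maximal) no ball of positive radius is contained in the residual set, the complement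 in $\partial\mathcal H$ of the union of the open balls of $\mathcal P$; - (Apollonian property) every sphere of $\mathcal P$ is a member of a cluster of five mutually tangent spheres of $\mathcal P$. 2. $\mathcal P$ is not the Soddy packing: there is no cluster of five mutually tangent spheres such that $\mathcal P$ is the set of all spheres obtained from it by repeatedly replacing one sphere of a cluster by the other sphere tangent to the remaining four. 3. $\mathcal P$ is not of lattice type: the additive group generated by $\mathcal P$ is not a lattice ($\mathbb Z$-span of a basis) in $\mathbb R^{1,4}$. 4. No perspective of $\mathcal P$ has only integer curvatures: there is no $E\in\mathcal L^+$ such that $n\cdot E/\|n\|\in\mathbb Z$ for all $n\in\mathcal P$. -/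

import Mathlib

noncomputable section

namespace SpherePacking

variable {N : ℕ}

/-! Vectors of `Fin N → ℝ` carry the product `u · v = uᵀ J v` of a symmetric matrix `J` of
signature `(1, N - 1)`; vectors `n` with `n · n < 0` are oriented spheres in `ℝ ^ (N - 2)`. -/

/-- The Lorentz product `uᵀ J v`. -/
def lor (J : Matrix (Fin N) (Fin N) ℝ) (u v : Fin N → ℝ) : ℝ :=
  dotProduct u (Matrix.mulVec J v)

/-- `J` is symmetric of signature `(1, N - 1)`: there is an orthogonal basis with exactly one
vector of norm `1` and all the others of norm `-1`. -/
def IsLorentzian (J : Matrix (Fin N) (Fin N) ℝ) : Prop :=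
  J.IsSymm ∧ ∃ (b : Module.Basis (Fin N) ℝ (Fin N → ℝ)) (i₀ : Fin N), ∀ i j,
    lor J (b i) (b j) = if i = j then (if i = i₀ then 1 else -1) else 0

/-- The length `‖n‖ = √(-n · n)` of a vector of negative norm. -/
def len (J : Matrix (Fin N) (Fin N) ℝ) (n : Fin N → ℝ) : ℝ :=
  Real.sqrt (-lor J n n)

/-- The multiple `n / ‖n‖` of norm `-1`. -/
def normalize (J : Matrix (Fin N) (Fin N) ℝ) (n : Fin N → ℝ) : Fin N → ℝ :=
  (len J n)⁻¹ • n

/-- The sheet `x · x = 1`, `x · D > 0` of the hyperboloid, a model of hyperbolic space. -/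
def hyp (J : Matrix (Fin N) (Fin N) ℝ) (D : Fin N → ℝ) : Set (Fin N → ℝ) :=
  {x | lor J x x = 1 ∧ 0 < lor J x D}

/-- The light cone `x · x = 0`, `x · D > 0`, whose rays are the points at infinity. -/
def lightCone (J : Matrix (Fin N) (Fin N) ℝ) (D : Fin N → ℝ) : Set (Fin N → ℝ) :=
  {x | lor J x x = 0 ∧ 0 < lor J x D}

/-- The open ball (ball, half-space or complement of a ball) bounded by the oriented sphere `n`:
the boundary points on the negative side of `n`. -/
def ball (J : Matrix (Fin N) (Fin N) ℝ) (D n : Fin N → ℝ) : Set (Fin N → ℝ) :=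
  {x ∈ lightCone J D | lor J n x < 0}

/-- The curvature of the sphere `n` when `E` is the point at infinity. -/
def curvature (J : Matrix (Fin N) (Fin N) ℝ) (E n : Fin N → ℝ) : ℝ :=
  lor J n E / len J n

/-- The group of isometries of hyperbolic space. -/
def isometries (J : Matrix (Fin N) (Fin N) ℝ) (D : Fin N → ℝ) :
    Set ((Fin N → ℝ) ≃ₗ[ℝ] (Fin N → ℝ)) :=
  {T | (∀ u v, lor J (T u) (T v) = lor J u v) ∧ T '' hyp J D = hyp J D}

/-- `P` is a packing: the spheres, all of the same norm `-k`, are pairwise tangent or disjoint,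
and the balls that they bound are pairwise disjoint. -/
def IsPacking (J : Matrix (Fin N) (Fin N) ℝ) (D : Fin N → ℝ) (P : Set (Fin N → ℝ)) : Prop :=
  (∃ k : ℝ, 0 < k ∧ ∀ n ∈ P, lor J n n = -k ∧ ∀ n' ∈ P, n ≠ n' → k ≤ lor J n n') ∧
  ∀ n ∈ P, ∀ n' ∈ P, n ≠ n' → Disjoint (ball J D n) (ball J D n')

/-- The residual set: the boundary points that lie in none of the open balls of `P`. -/
def residualSet (J : Matrix (Fin N) (Fin N) ℝ) (D : Fin N → ℝ) (P : Set (Fin N → ℝ)) :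
    Set (Fin N → ℝ) :=
  {x ∈ lightCone J D | ∀ n ∈ P, 0 ≤ lor J n x}

/-- `P` is maximal: no ball of positive radius fits into the residual set. -/
def IsMaximal (J : Matrix (Fin N) (Fin N) ℝ) (D : Fin N → ℝ) (P : Set (Fin N → ℝ)) : Prop :=
  ¬ ∃ m : Fin N → ℝ, lor J m m < 0 ∧ ball J D m ⊆ residualSet J D P

/-- `N` mutually (externally) tangent spheres, represented by vectors of one norm `-k`. -/
def IsCluster (J : Matrix (Fin N) (Fin N) ℝ) (c : Fin N → Fin N → ℝ) : Prop :=
  ∃ k : ℝ, 0 < k ∧ ∀ i j, lor J (c i) (c j) = if i = j then -k else k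

/-- Every sphere of `P` is a member of a cluster in `P` of `N` mutually tangent spheres. -/
def HasApollonianProperty (J : Matrix (Fin N) (Fin N) ℝ) (P : Set (Fin N → ℝ)) : Prop :=
  ∀ n ∈ P, ∃ c : Fin N → Fin N → ℝ, IsCluster J c ∧ (∀ i, c i ∈ P) ∧ ∃ i, c i = n

/-- The `R`-lattice `⊕ R bᵢ` of a basis `b` of `ℝ ^ N`. -/
def latticeOver (R : Subring ℝ) (b : Module.Basis (Fin N) ℝ (Fin N → ℝ)) : Set (Fin N → ℝ) :=
  {v | ∀ i, b.repr v i ∈ R}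

/-- `Γ` has a convex fundamental domain in hyperbolic space with finitely many faces: the
translates of the nonempty open polyhedron cut out by the finite set `T` are pairwise disjoint,
and those of the closed polyhedron cover. -/
def IsGeometricallyFinite (J : Matrix (Fin N) (Fin N) ℝ) (D : Fin N → ℝ)
    (Γ : Subgroup ((Fin N → ℝ) ≃ₗ[ℝ] (Fin N → ℝ))) : Prop :=
  ∃ T : Set (Fin N → ℝ), T.Finite ∧
    {x ∈ hyp J D | ∀ v ∈ T, 0 < lor J v x}.Nonempty ∧
    (∀ γ ∈ Γ, γ ≠ 1 → Disjoint (γ '' {x ∈ hyp J D | ∀ v ∈ T, 0 < lor J v x})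
      {x ∈ hyp J D | ∀ v ∈ T, 0 < lor J v x}) ∧
    ∀ x ∈ hyp J D, ∃ γ ∈ Γ, ∀ v ∈ T, 0 ≤ lor J v (γ x)

/-- `P` is crystallographic over `R`: up to normalization it is the orbit of a finite set `S` of
spheres in an `R`-lattice under a geometrically finite group of isometries of the lattice. -/
def IsCrystallographic (J : Matrix (Fin N) (Fin N) ℝ) (D : Fin N → ℝ) (R : Subring ℝ)
    (P : Set (Fin N → ℝ)) : Prop :=
  ∃ (b : Module.Basis (Fin N) ℝ (Fin N → ℝ)) (Γ : Subgroup ((Fin N → ℝ) ≃ₗ[ℝ] (Fin N → ℝ)))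
    (S : Set (Fin N → ℝ)),
    (∀ γ ∈ Γ, γ ∈ isometries J D ∧ γ '' latticeOver R b = latticeOver R b) ∧
    IsGeometricallyFinite J D Γ ∧
    S.Finite ∧ S ⊆ latticeOver R b ∧ (∀ n ∈ S, lor J n n < 0) ∧
    P = {x | ∃ γ ∈ Γ, ∃ n ∈ S, x = normalize J (γ n)}

/-- An Apollonian sphere packing in `ℝ ^ (N - 2)`: a sphere packing that is crystallographic
(over `R`), maximal, and has the Apollonian property. -/
def IsApollonian (J : Matrix (Fin N) (Fin N) ℝ) (D : Fin N → ℝ) (R : Subring ℝ)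
    (P : Set (Fin N → ℝ)) : Prop :=
  IsPacking J D P ∧ IsCrystallographic J D R P ∧ IsMaximal J D P ∧ HasApollonianProperty J P

/-- `P` is of lattice type: the additive group generated by `P` is a lattice, that is, the
`ℤ`-span of a basis of `ℝ ^ N`. -/
def IsLatticeType (P : Set (Fin N → ℝ)) : Prop :=
  ∃ b : Module.Basis (Fin N) ℝ (Fin N → ℝ),
    Submodule.span ℤ P = Submodule.span ℤ (Set.range b)

/-- The clusters reached from the cluster `e` by repeatedly exchanging one sphere for a sphere
that is tangent to the remaining ones. -/
inductive ReachableCluster (J : Matrix (Fin N) (Fin N) ℝ) (e : Fin N → Fin N → ℝ) :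
    (Fin N → Fin N → ℝ) → Prop
  | base : ReachableCluster J e e
  | step (c : Fin N → Fin N → ℝ) (i : Fin N) (v : Fin N → ℝ) :
      ReachableCluster J e c → IsCluster J (Function.update c i v) →
      ReachableCluster J e (Function.update c i v)

/-- `P` is (a perspective of) the Soddy sphere packing, for `N = 5`: start with five mutually
tangent spheres in `ℝ ^ 3`, and whenever five mutually tangent spheres are present, add for each
four of them the other sphere that is tangent to these four. All choices of the five initial
spheres, hence all images under Möbius transformations, are allowed. -/
def IsSoddyPacking (J : Matrix (Fin 5) (Fin 5) ℝ) (P : Set (Fin 5 → ℝ)) : Prop :=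
  ∃ e : Fin 5 → Fin 5 → ℝ, IsCluster J e ∧ P = {x | ∃ c i, ReachableCluster J e c ∧ x = c i}

/-! Packings of Coxeter graphs. The Gram matrix `J = [αᵢ · αⱼ]` of the nodes defines the product,
in coordinates in which the nodes are the standard basis. -/

/-- The node `αᵢ`. -/
def node (i : Fin N) : Fin N → ℝ := Pi.single i 1

/-- The weight `wᵢ`, with `wᵢ · αⱼ = δᵢⱼ`: the `i`-th row of `J⁻¹`. -/
def weight (J : Matrix (Fin N) (Fin N) ℝ) (i : Fin N) : Fin N → ℝ := J⁻¹ i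

/-- The group generated by the reflections `x ↦ x - 2 (αᵢ · x) / (αᵢ · αᵢ) αᵢ` in the nodes. -/
def weylGroup (J : Matrix (Fin N) (Fin N) ℝ) : Subgroup ((Fin N → ℝ) ≃ₗ[ℝ] (Fin N → ℝ)) :=
  Subgroup.closure {ρ | ∃ i : Fin N, ∀ x,
    ρ x = x - (2 * lor J (node i) x / lor J (node i) (node i)) • node i}

/-- The (Boyd–Maxwell) packing that the graph generates: the orbits under the group of all
weights that represent spheres, normalized. -/
def graphPacking (J : Matrix (Fin N) (Fin N) ℝ) : Set (Fin N → ℝ) :=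
  {x | ∃ γ ∈ weylGroup J, ∃ i, lor J (weight J i) (weight J i) < 0 ∧
    x = normalize J (γ (weight J i))}

/-- `D` is a timelike vector in the fundamental chamber `αᵢ · x ≥ 0`; it selects the sheet of the
hyperboloid that meets the chamber. -/
def IsChamberVector (J : Matrix (Fin N) (Fin N) ℝ) (D : Fin N → ℝ) : Prop :=
  0 < lor J D D ∧ ∀ i, 0 ≤ lor J (node i) D

/-- The Gram matrix of the Coxeter graph with nodes `α₁, …, α₅` of norm `-2`, edges of weight `1`
(angle `π / 3`) joining `α₁α₂`, `α₂α₃`, `α₃α₄`, `α₂α₅`, and an edge of weight `√3`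
(angle `π / 6`) joining `α₄α₅`. -/
def maxwellGram : Matrix (Fin 5) (Fin 5) ℝ :=
  !![-2, 1, 0, 0, 0;
     1, -2, 1, 0, 1;
     0, 1, -2, 1, 0;
     0, 0, 1, -2, Real.sqrt 3;
     0, 1, 0, Real.sqrt 3, -2]

end SpherePacking

end

noncomputable section

namespace SpherePacking

section General

variable {N : ℕ}

/-! ### The Lorentz product -/

section Product

variable (J : Matrix (Fin N) (Fin N) ℝ)

/-! In the basis of nodes the `i`-th coordinate of a vector is its pairing with `wᵢ`. The general
input is Coxeter theory: if `x` pairs nonnegatively with all nodes, then `γ x - x` is a nonnegative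
combination of nodes (`le_wordMap`), because roots are positive or negative according to word length
(`wordMap_node_nonneg`). With indices starting at `0`, the weights of negative norm are `w₀` and
`w₂`.

Packing: the pairing of `wᵢ` with `γ wⱼ` is a coordinate of `γ wⱼ`, hence smallest at `wⱼ`; after
scaling it is exactly `1` between the two orbits, and within one orbit distinct spheres gain enough
to reach `1` (`one_le_lor_of_mem`). The Weyl group preserves a `ℤ[√3]`-lattice containing the
weights, and the chamber is a fundamental domain: its translates cover because every point has a
nearest point in the orbit of an interior point (`exists_wordMap_mem_chamber`). Maximality: the part
of the chamber outside the half-spaces of `w₀` and `w₂` stays at bounded distance from the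
half-space of `w₀` (`sq_zero_le_of_chamber`), whereas a ball in the residual set would bound a
half-space with arbitrarily deep points. One explicit cluster meets both orbits, which gives the
Apollonian property.

The negative statements rest on the edge `√3`: the additive group generated by the packing contains
`v` and `√3 v` for nonzero multiples `v` of all roots in the orbit of the last node. This excludes a
lattice, and integral curvatures would force `E` to be orthogonal to every root. In a Soddy packing
each exchange is an integral operation on the initial cluster, so it would be of lattice type. -/

theorem lor_add_left (u v w : Fin N → ℝ) : lor J (u + v) w = lor J u w + lor J v w :=
  add_dotProduct _ _ _

theorem lor_sub_left (u v w : Fin N → ℝ) : lor J (u - v) w = lor J u w - lor J v w :=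
  sub_dotProduct _ _ _

theorem lor_neg_left (u w : Fin N → ℝ) : lor J (-u) w = -lor J u w :=
  neg_dotProduct _ _

theorem lor_smul_left (a : ℝ) (u w : Fin N → ℝ) : lor J (a • u) w = a * lor J u w :=
  smul_dotProduct _ _ _

theorem lor_zero_left (w : Fin N → ℝ) : lor J 0 w = 0 :=
  zero_dotProduct _

theorem lor_add_right (u v w : Fin N → ℝ) : lor J u (v + w) = lor J u v + lor J u w := by
  simp [lor, Matrix.mulVec_add]

theorem lor_sub_right (u v w : Fin N → ℝ) : lor J u (v - w) = lor J u v - lor J u w := by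
  simp [lor, Matrix.mulVec_sub]

theorem lor_neg_right (u w : Fin N → ℝ) : lor J u (-w) = -lor J u w := by
  simp [lor, Matrix.mulVec_neg]

theorem lor_smul_right (a : ℝ) (u w : Fin N → ℝ) : lor J u (a • w) = a * lor J u w := by
  simp [lor, Matrix.mulVec_smul]

theorem lor_zero_right (u : Fin N → ℝ) : lor J u 0 = 0 := by
  simp [lor]

theorem lor_node_left (i : Fin N) (x : Fin N → ℝ) : lor J (node i) x = J.mulVec x i := by
  simp [lor, node]

theorem lor_node_node (i j : Fin N) : lor J (node i) (node j) = J i j := by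
  rw [lor_node_left]; simp [node]

/-- The nodes are the standard basis, so a vector with nonnegative coordinates pairs nonnegatively
with the whole chamber. -/
theorem lor_eq_sum_left (u x : Fin N → ℝ) : lor J u x = ∑ i, u i * lor J (node i) x := by
  simp_rw [lor_node_left]; rfl

variable {J}

theorem lor_comm (hJ : J.IsSymm) (u v : Fin N → ℝ) : lor J u v = lor J v u := by
  unfold lor
  rw [Matrix.dotProduct_mulVec, ← Matrix.mulVec_transpose, hJ.eq, dotProduct_comm]

end Product

/-! ### Words in the simple reflections -/

/-- The reflection in a node of norm `-2`. -/
def refl (J : Matrix (Fin N) (Fin N) ℝ) (i : Fin N) : Module.End ℝ (Fin N → ℝ) where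
  toFun x := x + lor J (node i) x • node i
  map_add' x y := by rw [lor_add_right]; module
  map_smul' a x := by rw [lor_smul_right, RingHom.id_apply]; module

/-- The product of the reflections in the letters of a word. -/
def wordMap (J : Matrix (Fin N) (Fin N) ℝ) (L : List (Fin N)) : Module.End ℝ (Fin N → ℝ) :=
  (L.map (refl J)).prod

/-- The nodes have norm `-2`, and any two of them span an angle `π / 2`, `π / 3` or `π / 6`. -/
structure IsCoxeterGram (J : Matrix (Fin N) (Fin N) ℝ) : Prop where
  symm : J.IsSymm
  diag : ∀ i, J i i = -2
  off : ∀ i j, i ≠ j → J i j = 0 ∨ J i j = 1 ∨ J i j = √3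

section Words

variable {J : Matrix (Fin N) (Fin N) ℝ}

theorem refl_apply (i : Fin N) (x : Fin N → ℝ) :
    refl J i x = x + lor J (node i) x • node i := rfl

@[simp] theorem wordMap_nil : wordMap J [] = 1 := rfl

theorem wordMap_cons (i : Fin N) (L : List (Fin N)) :
    wordMap J (i :: L) = refl J i * wordMap J L := by simp [wordMap]

theorem wordMap_append (L L' : List (Fin N)) :
    wordMap J (L ++ L') = wordMap J L * wordMap J L' := by simp [wordMap]

theorem wordMap_singleton (i : Fin N) : wordMap J [i] = refl J i := by simp [wordMap]

namespace IsCoxeterGram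

variable (hJ : IsCoxeterGram J)
include hJ

theorem refl_refl (i : Fin N) (x : Fin N → ℝ) : refl J i (refl J i x) = x := by
  simp only [refl_apply, lor_add_right, lor_smul_right, lor_node_node, hJ.diag]; module

theorem refl_mul_refl (i : Fin N) : refl J i * refl J i = 1 :=
  LinearMap.ext fun x => hJ.refl_refl i x

theorem lor_refl (i : Fin N) (x y : Fin N → ℝ) :
    lor J (refl J i x) (refl J i y) = lor J x y := by
  simp only [refl_apply, lor_add_right, lor_smul_right, lor_add_left, lor_smul_left,
    lor_node_node, hJ.diag]
  rw [lor_comm hJ.symm x (node i)]; ring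

theorem lor_wordMap (L : List (Fin N)) (x y : Fin N → ℝ) :
    lor J (wordMap J L x) (wordMap J L y) = lor J x y := by
  induction L with
  | nil => rfl
  | cons i L ih => rw [wordMap_cons, Module.End.mul_apply, Module.End.mul_apply, hJ.lor_refl, ih]

theorem wordMap_mul_reverse (L : List (Fin N)) : wordMap J L * wordMap J L.reverse = 1 := by
  induction L with
  | nil => rfl
  | cons i L ih =>
    rw [List.reverse_cons, wordMap_append, wordMap_cons, wordMap_singleton, mul_assoc,
      ← mul_assoc (wordMap J L), ih, one_mul, hJ.refl_mul_refl]

theorem wordMap_reverse_mul (L : List (Fin N)) : wordMap J L.reverse * wordMap J L = 1 := by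
  simpa using hJ.wordMap_mul_reverse L.reverse

theorem wordMap_reverse_apply (L : List (Fin N)) (x : Fin N → ℝ) :
    wordMap J L.reverse (wordMap J L x) = x := by
  rw [← Module.End.mul_apply, hJ.wordMap_reverse_mul]; rfl

theorem lor_wordMap_left (L : List (Fin N)) (x y : Fin N → ℝ) :
    lor J (wordMap J L x) y = lor J x (wordMap J L.reverse y) := by
  rw [← hJ.lor_wordMap L.reverse, hJ.wordMap_reverse_apply]

end IsCoxeterGram

/-! ### Word length, positivity of roots, and the order on orbits of dominant vectors. -/

/-- The least number of simple reflections with a given product. -/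
def wordLength (J : Matrix (Fin N) (Fin N) ℝ) (f : Module.End ℝ (Fin N → ℝ)) : ℕ :=
  sInf {n | ∃ L, L.length = n ∧ wordMap J L = f}

theorem wordLength_wordMap_le (L : List (Fin N)) : wordLength J (wordMap J L) ≤ L.length :=
  Nat.sInf_le ⟨L, rfl, rfl⟩

theorem exists_reduced (L : List (Fin N)) :
    ∃ L', wordMap J L' = wordMap J L ∧ L'.length = wordLength J (wordMap J L) := by
  obtain ⟨L', h, h'⟩ := Nat.sInf_mem (s := {n | ∃ L', L'.length = n ∧ wordMap J L' = wordMap J L})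
    ⟨_, L, rfl, rfl⟩
  exact ⟨L', h', h⟩

theorem wordLength_append_le (L L' : List (Fin N)) :
    wordLength J (wordMap J (L ++ L')) ≤ wordLength J (wordMap J L) + L'.length := by
  obtain ⟨M, hM, hl⟩ := exists_reduced (J := J) L
  rw [wordMap_append, ← hM, ← wordMap_append]
  exact (wordLength_wordMap_le _).trans (by rw [List.length_append, hM, hl])

/-- An element that is not the identity has a shortest word `i :: L'`, and then `L'` is shortest too. -/
theorem exists_first_letter {L : List (Fin N)} (hL : wordMap J L ≠ 1) :
    ∃ i L', wordMap J (i :: L') = wordMap J L ∧ wordLength J (wordMap J (i :: L')) = L'.length + 1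
      ∧ wordLength J (wordMap J L') = L'.length := by
  obtain ⟨M, hM, hl⟩ := exists_reduced (J := J) L
  rcases M with _ | ⟨i, L'⟩
  · exact absurd hM.symm hL
  refine ⟨i, L', hM, by rw [hM, ← hl, List.length_cons], le_antisymm (wordLength_wordMap_le _) ?_⟩
  obtain ⟨U, hU, hUl⟩ := exists_reduced (J := J) L'
  have := wordLength_wordMap_le (J := J) (i :: U)
  rw [wordMap_cons, hU, ← wordMap_cons, hM, ← hl, List.length_cons, List.length_cons] at this
  omega

/-- Here and below `≤` is the coordinatewise order: the difference is a nonnegative combination of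
nodes. -/
theorem refl_apply_ge {x : Fin N → ℝ} {i : Fin N} (hx : 0 ≤ lor J (node i) x) :
    x ≤ refl J i x :=
  le_add_of_nonneg_right (smul_nonneg hx (Pi.single_nonneg.2 zero_le_one))

/-- The word `… s t s t` of length `k`, which ends in `t`. -/
def altWord (s t : Fin N) : ℕ → List (Fin N)
  | 0 => []
  | k + 1 => (if Even k then t else s) :: altWord s t k

theorem length_altWord (s t : Fin N) (k : ℕ) : (altWord s t k).length = k := by
  induction k with
  | zero => rfl
  | succ k ih => simp [altWord, ih]

theorem altWord_add (s t : Fin N) (m k : ℕ) :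
    ∃ P : List (Fin N), P.length = k ∧ altWord s t (m + k) = P ++ altWord s t m := by
  induction k with
  | zero => exact ⟨[], rfl, rfl⟩
  | succ k ih =>
    obtain ⟨P, hP, h⟩ := ih
    exact ⟨_ :: P, by simp [hP], by rw [← add_assoc, altWord, h, List.cons_append]⟩

theorem refl_self_apply_comb (h : J s s = -2) (x : Fin N → ℝ) (a b : ℝ) :
    refl J s (x + a • node s + b • node t) =
      x + (lor J (node s) x - a + J s t * b) • node s + b • node t := by
  simp only [refl_apply, lor_add_right, lor_smul_right, lor_node_node, h]; module

theorem refl_other_apply_comb (h : J t t = -2) (x : Fin N → ℝ) (a b : ℝ) :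
    refl J t (x + a • node s + b • node t) =
      x + a • node s + (lor J (node t) x - b + J t s * a) • node t := by
  simp only [refl_apply, lor_add_right, lor_smul_right, lor_node_node, h]; module

namespace IsCoxeterGram

variable (hJ : IsCoxeterGram J)
include hJ

/-- The braid relation of two nodes, and the positivity of the roots between them. -/
theorem exists_braid {s t : Fin N} (hst : s ≠ t) :
    ∃ m, wordMap J (altWord s t (m + 1)) * refl J s = wordMap J (altWord s t m) ∧
      ∀ k ≤ m, ∃ a b : ℝ, 0 ≤ a ∧ 0 ≤ b ∧
        wordMap J (altWord s t k) (node s) = a • node s + b • node t := by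
  have hts : J t s = J s t := hJ.symm.apply s t
  have hs := fun x a b => refl_self_apply_comb (t := t) (hJ.diag s) x a b
  have ht := fun x a b => refl_other_apply_comb (s := s) (hJ.diag t) x a b
  have hs0 := fun a b => hs 0 a b
  have ht0 := fun a b => ht 0 a b
  simp only [lor_zero_right, zero_add, zero_sub] at hs0 ht0
  have n0 : node s = (1 : ℝ) • node s + (0 : ℝ) • node t := by module
  have h3 : √3 * √3 = 3 := Real.mul_self_sqrt (by norm_num)
  have x0 : ∀ x : Fin N → ℝ, x = x + (0 : ℝ) • node s + (0 : ℝ) • node t := fun x => by module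
  have key : ∀ {x : Fin N → ℝ} {a b a' b' : ℝ}, a = a' → b = b' →
      x + a • node s + b • node t = x + a' • node s + b' • node t := by
    rintro x a b _ _ rfl rfl; rfl
  have r0 : wordMap J (altWord s t 0) (node s) = (1 : ℝ) • node s + (0 : ℝ) • node t := n0
  have e3 : ¬ Even 3 := by decide
  have e4 : Even 4 := by decide
  have e5 : ¬ Even 5 := by decide
  -- The product of the two reflections has order 2, 3 or 6, and `m` is this order minus one. The
  -- alternating words of length at most `m` carry `node s` to positive roots of the dihedral
  -- system.
  rcases hJ.off s t hst with h | h | h <;> rw [h] at hts hs hs0 <;> rw [hts] at ht ht0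
  · refine ⟨1, LinearMap.ext fun x => ?_, fun k hk => ?_⟩
    · conv_lhs => rw [x0 x]
      conv_rhs => rw [x0 x]
      simp only [altWord, wordMap_cons, hs, ht, Module.End.mul_apply, wordMap_nil,
        Module.End.one_apply, Nat.not_even_one, Even.zero, if_true, if_false]
      exact key (by ring) (by ring)
    · have r1 : wordMap J (altWord s t 1) (node s) = (1 : ℝ) • node s + (0 : ℝ) • node t := by
        rw [altWord, wordMap_cons, Module.End.mul_apply, r0, if_pos (by decide), ht0]
        norm_num
      interval_cases k
      · exact ⟨1, 0, by norm_num, by norm_num, r0⟩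
      · exact ⟨1, 0, by norm_num, by norm_num, r1⟩
  · refine ⟨2, LinearMap.ext fun x => ?_, fun k hk => ?_⟩
    · conv_lhs => rw [x0 x]
      conv_rhs => rw [x0 x]
      simp only [altWord, wordMap_cons, hs, ht, Module.End.mul_apply, wordMap_nil,
        Module.End.one_apply, Nat.not_even_one, even_two, Even.zero, if_true, if_false]
      exact key (by ring) (by ring)
    · have r1 : wordMap J (altWord s t 1) (node s) = (1 : ℝ) • node s + (1 : ℝ) • node t := by
        rw [altWord, wordMap_cons, Module.End.mul_apply, r0, if_pos (by decide), ht0]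
        norm_num
      have r2 : wordMap J (altWord s t 2) (node s) = (0 : ℝ) • node s + (1 : ℝ) • node t := by
        rw [altWord, wordMap_cons, Module.End.mul_apply, r1, if_neg (by decide), hs0]
        norm_num
      interval_cases k
      · exact ⟨1, 0, by norm_num, by norm_num, r0⟩
      · exact ⟨1, 1, by norm_num, by norm_num, r1⟩
      · exact ⟨0, 1, by norm_num, by norm_num, r2⟩
  · have p2 : √3 ^ 2 = 3 := by rw [pow_two, h3]
    have p3 : √3 ^ 3 = 3 * √3 := by rw [pow_succ, p2]
    have p4 : √3 ^ 4 = 9 := by rw [pow_succ, p3, mul_assoc, h3]; norm_num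
    have p5 : √3 ^ 5 = 9 * √3 := by rw [pow_succ, p4]
    have p6 : √3 ^ 6 = 27 := by rw [pow_succ, p5, mul_assoc, h3]; norm_num
    refine ⟨5, LinearMap.ext fun x => ?_, fun k hk => ?_⟩
    · conv_lhs => rw [x0 x]
      conv_rhs => rw [x0 x]
      simp only [altWord, wordMap_cons, hs, ht, Module.End.mul_apply, wordMap_nil,
        Module.End.one_apply, Nat.not_even_one, even_two, Even.zero, if_true, if_false, e3, e4, e5]
      refine key ?_ ?_ <;>
      · ring_nf
        simp only [p2, p3, p4, p5, p6]
        ring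
    · have r1 : wordMap J (altWord s t 1) (node s) = (1 : ℝ) • node s + √3 • node t := by
        rw [altWord, wordMap_cons, Module.End.mul_apply, r0, if_pos (by decide), ht0]
        simp
      have r2 : wordMap J (altWord s t 2) (node s) = (2 : ℝ) • node s + √3 • node t := by
        rw [altWord, wordMap_cons, Module.End.mul_apply, r1, if_neg (by decide), hs0, h3]
        norm_num
      have r3 : wordMap J (altWord s t 3) (node s) = (2 : ℝ) • node s + √3 • node t := by
        rw [altWord, wordMap_cons, Module.End.mul_apply, r2, if_pos (by decide), ht0]
        congr 2; ring
      have r4 : wordMap J (altWord s t 4) (node s) = (1 : ℝ) • node s + √3 • node t := by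
        rw [altWord, wordMap_cons, Module.End.mul_apply, r3, if_neg (by decide), hs0, h3]
        norm_num
      have r5 : wordMap J (altWord s t 5) (node s) = (1 : ℝ) • node s + (0 : ℝ) • node t := by
        rw [altWord, wordMap_cons, Module.End.mul_apply, r4, if_pos (by decide), ht0]
        simp
      interval_cases k
      · exact ⟨1, 0, by positivity, by positivity, r0⟩
      · exact ⟨1, √3, by positivity, by positivity, r1⟩
      · exact ⟨2, √3, by positivity, by positivity, r2⟩
      · exact ⟨2, √3, by positivity, by positivity, r3⟩
      · exact ⟨1, √3, by positivity, by positivity, r4⟩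
      · exact ⟨1, 0, by positivity, by positivity, r5⟩


/-- A root `f α` is positive if appending the reflection in `α` does not shorten `f`. -/
theorem wordMap_node_nonneg (n : ℕ) : ∀ L : List (Fin N), wordLength J (wordMap J L) = n →
    ∀ s, n ≤ wordLength J (wordMap J (L ++ [s])) → 0 ≤ wordMap J L (node s) := by
  induction n using Nat.strong_induction_on with
  | _ n ih =>
  intro L hL s hs
  obtain ⟨M, hM, hMl⟩ := exists_reduced (J := J) L
  rw [wordMap_append, ← hM, ← wordMap_append] at hs
  rw [← hM] at hL hMl ⊢
  rw [hL] at hMl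
  rcases List.eq_nil_or_concat' M with rfl | ⟨M', t, rfl⟩
  · exact Pi.single_nonneg.2 zero_le_one
  -- If `s = t`, appending `s` would cancel the last letter and shorten the word.
  have hst : s ≠ t := by
    rintro rfl
    rw [List.append_assoc, wordMap_append, List.singleton_append, wordMap_cons, wordMap_singleton,
      hJ.refl_mul_refl, mul_one] at hs
    have := wordLength_wordMap_le (J := J) M'
    rw [List.length_append, List.length_singleton] at hMl
    omega
  classical
  -- split off an alternating word of maximal length
  let Q : ℕ → Prop := fun k => ∃ V, wordMap J (V ++ altWord s t k) = wordMap J (M' ++ [t]) ∧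
    V.length + k = n
  have hQ1 : Q 1 := ⟨M', by simp [altWord], by simpa using hMl⟩
  have hQn : 1 ≤ n := by rw [← hMl]; simp
  set k := Nat.findGreatest Q n with hk
  obtain ⟨V, hV, hVl⟩ : Q k := Nat.findGreatest_spec hQn hQ1
  have hk1 : 1 ≤ k := Nat.le_findGreatest hQn hQ1
  have hmax : ¬ Q (k + 1) := fun h => by
    have hle : k + 1 ≤ n := by obtain ⟨V', -, h'⟩ := h; omega
    exact absurd (Nat.le_findGreatest hle h) (by omega)
  clear_value k
  have hVlen : wordLength J (wordMap J V) = V.length := by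
    refine le_antisymm (wordLength_wordMap_le _) ?_
    have := wordLength_append_le (J := J) V (altWord s t k)
    rw [hV, hL, length_altWord] at this
    omega
  obtain ⟨m, hm, hpos⟩ := hJ.exists_braid hst
  -- An alternating part longer than `m`, followed by `s`, would shrink by the braid relation, so
  -- that appending `s` would shorten the word.
  have hkm : k ≤ m := by
    by_contra! hlt
    obtain ⟨d, hd⟩ := Nat.exists_eq_add_of_le hlt
    obtain ⟨P, hP, hPe⟩ := altWord_add s t (m + 1) d
    rw [Nat.succ_eq_add_one] at hd
    rw [hd, hPe] at hV
    rw [wordMap_append, ← hV, wordMap_singleton, wordMap_append, wordMap_append, mul_assoc,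
      mul_assoc, hm, ← wordMap_append, ← wordMap_append] at hs
    have := hs.trans (wordLength_wordMap_le _)
    simp only [List.length_append, length_altWord] at this
    omega
  -- `V` is shorter than `n`, so induction applies unless appending `r` shortens `V`. Then `V` can
  -- be made to end in `r`: either `r` prolongs the alternating part, against the maximality of `k`,
  -- or it cancels its first letter, against the minimality of the word.
  have hroot : ∀ r, r = s ∨ r = t → 0 ≤ wordMap J V (node r) := by
    intro r hr
    refine ih V.length (by omega) V hVlen r ?_
    by_contra! hlt
    obtain ⟨U, hU, hUl⟩ := exists_reduced (J := J) (V ++ [r])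
    rw [← hUl] at hlt
    have hV' : wordMap J V = wordMap J (U ++ [r]) := by
      rw [wordMap_append, hU, wordMap_append, wordMap_singleton, mul_assoc, hJ.refl_mul_refl,
        mul_one]
    have hUV : V.length ≤ U.length + 1 := by
      rw [← hVlen, hV']; exact (wordLength_wordMap_le _).trans (by simp)
    by_cases hr' : r = if Even k then t else s
    · refine hmax ⟨U, ?_, by omega⟩
      rw [← hV, altWord, ← hr', wordMap_append, wordMap_cons, ← mul_assoc, ← wordMap_singleton,
        ← wordMap_append, ← hV', ← wordMap_append]
    · obtain ⟨j, rfl⟩ := Nat.exists_eq_add_of_le' hk1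
      have hr2 : r = if Even j then t else s := by
        simp only [Nat.even_add_one] at hr'
        rcases hr with rfl | rfl <;> by_cases hj : Even j <;> simp_all
      have : wordMap J (U ++ altWord s t j) = wordMap J (M' ++ [t]) := by
        rw [← hV, altWord, ← hr2, wordMap_append V, wordMap_cons, hV', wordMap_append U [r],
          wordMap_singleton, mul_assoc, ← mul_assoc (refl J r), hJ.refl_mul_refl, one_mul,
          wordMap_append]
      have h' := wordLength_wordMap_le (J := J) (U ++ altWord s t j)
      rw [this, hL, List.length_append, length_altWord] at h'
      omega
  obtain ⟨a, b, ha, hb, hab⟩ := hpos k hkm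
  rw [← hV, wordMap_append, Module.End.mul_apply, hab, map_add, map_smul, map_smul]
  exact add_nonneg (smul_nonneg ha (hroot s (.inl rfl))) (smul_nonneg hb (hroot t (.inr rfl)))

/-- An element with a shortest word `i :: L` moves dominant vectors up, by at least as much as the
reflection in `αᵢ`. -/
theorem wordMap_ge_of_reduced (i : Fin N) (L : List (Fin N))
    (hL : wordLength J (wordMap J (i :: L)) = L.length + 1) (x : Fin N → ℝ)
    (hx : ∀ k, 0 ≤ lor J (node k) x) : refl J i x ≤ wordMap J (i :: L) x := by
  induction L using List.reverseRecOn with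
  | nil => rw [wordMap_singleton]
  | append_singleton L j ih =>
    have h1 : wordLength J (wordMap J (i :: L)) = L.length + 1 := by
      refine le_antisymm (wordLength_wordMap_le _) ?_
      have := wordLength_append_le (J := J) (i :: L) [j]
      rw [List.cons_append, hL] at this
      simpa using this
    have h2 : 0 ≤ wordMap J (i :: L) (node j) :=
      hJ.wordMap_node_nonneg _ _ h1 j (by rw [List.cons_append, hL]; simp)
    -- The new last letter adds a nonnegative multiple of the positive root `wordMap J (i :: L)
    -- (node j)`.
    rw [← List.cons_append, wordMap_append, wordMap_singleton, Module.End.mul_apply,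
      refl_apply j, map_add, map_smul]
    exact (ih h1).trans (le_add_of_nonneg_right (smul_nonneg (hx j) h2))

/-- The first letter of a shortest word already moves `x` up, and the whole word moves it at least
as far. So a dominant vector is the lowest of its orbit. -/
theorem le_wordMap (L : List (Fin N)) (x : Fin N → ℝ) (hx : ∀ k, 0 ≤ lor J (node k) x) :
    x ≤ wordMap J L x := by
  by_cases h : wordMap J L = 1
  · rw [h]; rfl
  · obtain ⟨i, L', h1, h2, -⟩ := exists_first_letter h
    rw [← h1]
    exact (refl_apply_ge (hx i)).trans (hJ.wordMap_ge_of_reduced i L' h2 x hx)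

/-- The interior of the chamber is disjoint from its images. -/
theorem wordMap_eq_one_of_chamber {L : List (Fin N)} {x : Fin N → ℝ}
    (hx : ∀ k, 0 ≤ lor J (node k) x) (hy : ∀ k, 0 < lor J (node k) (wordMap J L x)) :
    wordMap J L = 1 := by
  by_contra h
  obtain ⟨i, L', h1, h2, h3⟩ := exists_first_letter h
  have hneg := hy i
  rw [← h1, wordMap_cons, Module.End.mul_apply, refl_apply, lor_add_right, lor_smul_right,
    lor_node_node, hJ.diag, lor_comm hJ.symm, hJ.lor_wordMap_left, lor_comm hJ.symm] at hneg
  have hrev : ∀ K : List (Fin N), wordLength J (wordMap J K.reverse) ≤ wordLength J (wordMap J K)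
      := by
    intro K
    obtain ⟨U, hU, hUl⟩ := exists_reduced (J := J) K
    have : wordMap J K.reverse = wordMap J U.reverse :=
      left_inv_eq_right_inv (hJ.wordMap_reverse_mul K) (hU ▸ hJ.wordMap_mul_reverse U)
    rw [this, ← hUl]
    exact (wordLength_wordMap_le _).trans_eq (List.length_reverse ..)
  -- The inverse of `i :: L'` is longer than that of `L'`, so this root is positive. Its pairing
  -- with `x` is minus the pairing of `αᵢ` with the image of `x`, which was assumed positive.
  have h4 : 0 ≤ wordMap J L'.reverse (node i) := by
    refine hJ.wordMap_node_nonneg _ _ rfl i ((hrev L').trans ?_)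
    rw [h3]
    have := hrev (i :: L').reverse
    rw [List.reverse_reverse, h2] at this
    rw [List.reverse_cons] at this
    omega
  have h5 : 0 ≤ lor J (wordMap J L'.reverse (node i)) x := by
    rw [lor_eq_sum_left]
    exact Finset.sum_nonneg fun k _ => mul_nonneg (h4 k) (hx k)
  linarith

end IsCoxeterGram

end Words

end General

/-! ### Elements of the Weyl group as words -/

section Weyl

variable {N : ℕ} {J : Matrix (Fin N) (Fin N) ℝ}

theorem IsCoxeterGram.exists_word (hJ : IsCoxeterGram J) {γ : (Fin N → ℝ) ≃ₗ[ℝ] (Fin N → ℝ)}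
    (hγ : γ ∈ weylGroup J) : ∃ L, ∀ x, γ x = wordMap J L x := by
  induction hγ using Subgroup.closure_induction with
  | mem ρ hρ =>
    obtain ⟨i, hi⟩ := hρ
    refine ⟨[i], fun x => ?_⟩
    rw [hi, wordMap_singleton, refl_apply, lor_node_node, hJ.diag]
    module
  | one => exact ⟨[], fun x => rfl⟩
  | mul f g _ _ hf hg =>
    obtain ⟨L, hL⟩ := hf
    obtain ⟨M, hM⟩ := hg
    exact ⟨L ++ M, fun x => by
      rw [wordMap_append, Module.End.mul_apply, ← hM, ← hL, LinearEquiv.mul_apply]⟩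
  | inv f _ hf =>
    obtain ⟨L, hL⟩ := hf
    refine ⟨L.reverse, fun x => ?_⟩
    rw [← hJ.wordMap_reverse_apply L (f⁻¹ x), ← hL]
    exact congrArg _ (f.apply_symm_apply x)

theorem IsCoxeterGram.exists_mem_weylGroup (hJ : IsCoxeterGram J) (L : List (Fin N)) :
    ∃ γ ∈ weylGroup J, ∀ x, γ x = wordMap J L x := by
  induction L with
  | nil => exact ⟨1, one_mem _, fun x => rfl⟩
  | cons i L ih =>
    obtain ⟨γ, hγ, h⟩ := ih
    let ρ := LinearEquiv.ofInvolutive (refl J i) (hJ.refl_refl i)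
    refine ⟨ρ * γ, mul_mem (Subgroup.subset_closure ⟨i, fun x => ?_⟩) hγ, fun x => ?_⟩
    · rw [lor_node_node, hJ.diag]
      change refl J i x = _
      rw [refl_apply]; module
    · rw [wordMap_cons, Module.End.mul_apply, ← h]; rfl

end Weyl

/-! ### The Lorentz space of Maxwell's graph -/

local notation "𝐉" => maxwellGram

theorem sqrt_three_mul_self : √(3 : ℝ) * √3 = 3 := Real.mul_self_sqrt (by norm_num)

theorem sqrt_three_lt : √(3 : ℝ) < 1.7321 := by
  rw [Real.sqrt_lt' (by norm_num)]; norm_num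

theorem lt_sqrt_three : (1.732 : ℝ) < √3 := by
  rw [Real.lt_sqrt (by norm_num)]; norm_num

theorem isCoxeterGram_maxwellGram : IsCoxeterGram 𝐉 where
  symm := by
    ext i j
    fin_cases i <;> fin_cases j <;> rfl
  diag i := by fin_cases i <;> rfl
  off i j h := by
    fin_cases i <;> fin_cases j <;> simp [maxwellGram] at h ⊢

theorem lor_maxwell_comm (u v : Fin 5 → ℝ) : lor 𝐉 u v = lor 𝐉 v u :=
  lor_comm isCoxeterGram_maxwellGram.symm u v

theorem lor_node_zero (x : Fin 5 → ℝ) : lor 𝐉 (node 0) x = -2 * x 0 + x 1 := by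
  simp [lor_node_left, maxwellGram, Matrix.mulVec, dotProduct, Fin.sum_univ_five]

theorem lor_node_one (x : Fin 5 → ℝ) : lor 𝐉 (node 1) x = x 0 - 2 * x 1 + x 2 + x 4 := by
  simp [lor_node_left, maxwellGram, Matrix.mulVec, dotProduct, Fin.sum_univ_five]; ring

theorem lor_node_two (x : Fin 5 → ℝ) : lor 𝐉 (node 2) x = x 1 - 2 * x 2 + x 3 := by
  simp [lor_node_left, maxwellGram, Matrix.mulVec, dotProduct, Fin.sum_univ_five]; ring

theorem lor_node_three (x : Fin 5 → ℝ) : lor 𝐉 (node 3) x = x 2 - 2 * x 3 + √3 * x 4 := by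
  simp [lor_node_left, maxwellGram, Matrix.mulVec, dotProduct, Fin.sum_univ_five]; ring

theorem lor_node_four (x : Fin 5 → ℝ) : lor 𝐉 (node 4) x = x 1 + √3 * x 3 - 2 * x 4 := by
  simp [lor_node_left, maxwellGram, Matrix.mulVec, dotProduct, Fin.sum_univ_five]; ring

theorem lor_eq_five (u x : Fin 5 → ℝ) : lor 𝐉 u x =
    u 0 * (-2 * x 0 + x 1) + u 1 * (x 0 - 2 * x 1 + x 2 + x 4) + u 2 * (x 1 - 2 * x 2 + x 3) +
      u 3 * (x 2 - 2 * x 3 + √3 * x 4) + u 4 * (x 1 + √3 * x 3 - 2 * x 4) := by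
  rw [lor_eq_sum_left, Fin.sum_univ_five, lor_node_zero, lor_node_one, lor_node_two,
    lor_node_three, lor_node_four]

/-- Four linear forms that, with `(1 + √3) x₃`, diagonalize the Lorentz product. -/
def spacePart (x : Fin 5 → ℝ) : Fin 4 → ℝ :=
  ![2 * x 0 - x 1, 2 * x 2 - x 1 - x 3, 2 * x 4 - x 1 - √3 * x 3, x 1 - (1 + √3) * x 3]

/-- One positive and four negative squares: coordinate `3` serves as time, and the causal
inequalities below become Cauchy–Schwarz for `spacePart`. -/
theorem two_mul_lor (u v : Fin 5 → ℝ) : 2 * lor 𝐉 u v =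
    ((1 + √3) * u 3) * ((1 + √3) * v 3) - ∑ i, spacePart u i * spacePart v i := by
  rw [lor_eq_five, Fin.sum_univ_four]
  simp only [spacePart, Matrix.cons_val]
  linear_combination (u 3 * v 3) * sqrt_three_mul_self

theorem eq_zero_of_three_eq_zero {x : Fin 5 → ℝ} (hx : 0 ≤ lor 𝐉 x x) (h : x 3 = 0) : x = 0 := by
  have h2 := two_mul_lor x x
  simp only [h, Fin.sum_univ_four, spacePart, Matrix.cons_val, mul_zero, sub_zero] at h2
  have h1 : x 1 = 0 := by nlinarith
  rw [h1] at h2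
  have h0 : x 0 = 0 := by nlinarith
  have h2' : x 2 = 0 := by nlinarith
  have h4 : x 4 = 0 := by nlinarith
  ext i
  fin_cases i <;> assumption

theorem lor_nonneg_of_forward {u v : Fin 5 → ℝ} (hu : 0 ≤ lor 𝐉 u u) (hv : 0 ≤ lor 𝐉 v v)
    (hu3 : 0 ≤ u 3) (hv3 : 0 ≤ v 3) : 0 ≤ lor 𝐉 u v := by
  have h1 := two_mul_lor u u
  have h2 := two_mul_lor v v
  have h3 := two_mul_lor u v
  have cs := Finset.sum_mul_sq_le_sq_mul_sq Finset.univ (spacePart u) (spacePart v)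
  simp only [← pow_two] at h1 h2
  have hA : 0 ≤ (1 + √3) * u 3 := by positivity
  have hB : 0 ≤ (1 + √3) * v 3 := by positivity
  have := abs_le_of_sq_le_sq' (cs.trans (mul_le_mul (by linarith : _ ≤ ((1 + √3) * u 3) ^ 2)
    (by linarith : _ ≤ ((1 + √3) * v 3) ^ 2) (by positivity) (by positivity))
    |>.trans_eq (mul_pow _ _ 2).symm) (mul_nonneg hA hB)
  linarith [this.2]

theorem lor_pos_of_forward {u v : Fin 5 → ℝ} (hu : 0 < lor 𝐉 u u) (hv : 0 ≤ lor 𝐉 v v)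
    (hu3 : 0 < u 3) (hv3 : 0 < v 3) : 0 < lor 𝐉 u v := by
  have h1 := two_mul_lor u u
  have h2 := two_mul_lor v v
  have h3 := two_mul_lor u v
  have cs := Finset.sum_mul_sq_le_sq_mul_sq Finset.univ (spacePart u) (spacePart v)
  simp only [← pow_two] at h1 h2
  have hA : 0 < (1 + √3) * u 3 := by positivity
  have hB : 0 < (1 + √3) * v 3 := by positivity
  have h4 : (∑ i, spacePart u i * spacePart v i) ^ 2 <
      ((1 + √3) * u 3 * ((1 + √3) * v 3)) ^ 2 := by
    rw [mul_pow _ ((1 + √3) * v 3)]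
    refine (cs.trans (mul_le_mul_of_nonneg_left (by linarith : _ ≤ ((1 + √3) * v 3) ^ 2)
      (by positivity))).trans_lt (mul_lt_mul_of_pos_right (by linarith) (by positivity))
  linarith [(abs_lt_of_sq_lt_sq' h4 (by positivity)).2]

/-- In the closed solid light cone, the side of a timelike vector is read off from one coordinate. -/
theorem lor_pos_iff {x D : Fin 5 → ℝ} (hD : 0 < lor 𝐉 D D) (hD3 : 0 < D 3)
    (hx : 0 ≤ lor 𝐉 x x) : 0 < lor 𝐉 x D ↔ 0 < x 3 := by
  refine ⟨fun h => ?_, fun h => by rw [lor_maxwell_comm]; exact lor_pos_of_forward hD hx hD3 h⟩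
  by_contra! hn
  rcases hn.lt_or_eq with hn | hn
  · have := lor_pos_of_forward (v := -x) hD (by simpa [lor_neg_left, lor_neg_right]) hD3
      (by simpa using hn)
    rw [lor_neg_right, lor_maxwell_comm] at this
    linarith
  · rw [eq_zero_of_three_eq_zero hx hn, lor_zero_left] at h
    exact lt_irrefl _ h

/-- Every admissible `D` selects the same sheet, so `D` can be replaced by the sign of coordinate
`3`. -/
theorem three_pos_of_chamber {D : Fin 5 → ℝ} (hD : IsChamberVector 𝐉 D) : 0 < D 3 := by
  have h0 := hD.2 0
  have h1 := hD.2 1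
  have h2 := hD.2 2
  have h3 := hD.2 3
  have h4 := hD.2 4
  rw [lor_node_zero] at h0
  rw [lor_node_one] at h1
  rw [lor_node_two] at h2
  rw [lor_node_three] at h3
  rw [lor_node_four] at h4
  -- The coefficients are row `3` of the inverse Gram matrix, all positive.
  have key : D 3 = (√3 - 1) / 2 * (-2 * D 0 + D 1) + (√3 - 1) * (D 0 - 2 * D 1 + D 2 + D 4) +
      1 / 2 * (D 1 - 2 * D 2 + D 3) + (2 - √3) * (D 2 - 2 * D 3 + √3 * D 4) +
      (3 / 2 * √3 - 2) * (D 1 + √3 * D 3 - 2 * D 4) := by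
    linear_combination (-3 / 2 * D 3 + D 4) * sqrt_three_mul_self
  have hs := lt_sqrt_three
  have hs' := sqrt_three_lt
  have : 0 ≤ D 3 := by
    rw [key]
    have a1 : 0 ≤ √3 - 1 := by linarith
    have a2 : 0 ≤ 2 - √3 := by linarith
    have a3 : 0 ≤ 3 / 2 * √3 - 2 := by linarith
    positivity
  refine this.lt_of_ne fun h => ?_
  have h := eq_zero_of_three_eq_zero hD.1.le h.symm
  have := hD.1
  rw [h, lor_zero_left] at this
  exact lt_irrefl _ this

theorem mem_hyp_iff {D x : Fin 5 → ℝ} (hD : IsChamberVector 𝐉 D) :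
    x ∈ hyp 𝐉 D ↔ lor 𝐉 x x = 1 ∧ 0 < x 3 :=
  and_congr_right fun h => lor_pos_iff hD.1 (three_pos_of_chamber hD) (h ▸ zero_le_one)

theorem mem_lightCone_iff {D x : Fin 5 → ℝ} (hD : IsChamberVector 𝐉 D) :
    x ∈ lightCone 𝐉 D ↔ lor 𝐉 x x = 0 ∧ 0 < x 3 :=
  and_congr_right fun h => lor_pos_iff hD.1 (three_pos_of_chamber hD) h.ge

/-! ### Half-spaces of hyperbolic space and the balls at infinity. -/

theorem lor_self_neg_of_orthogonal {x y : Fin 5 → ℝ} (hx : 0 < lor 𝐉 x x) (hx3 : 0 < x 3)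
    (hxy : lor 𝐉 x y = 0) (hy : y ≠ 0) : lor 𝐉 y y < 0 := by
  by_contra! h
  rw [lor_maxwell_comm] at hxy
  rcases lt_trichotomy (y 3) 0 with h3 | h3 | h3
  · have := (lor_pos_iff (x := -y) hx hx3 (by simpa [lor_neg_left, lor_neg_right])).2
      (by simpa using h3)
    rw [lor_neg_left, hxy] at this
    simp at this
  · exact hy (eq_zero_of_three_eq_zero h h3)
  · exact ((lor_pos_iff hx hx3 h).2 h3).ne' hxy

theorem lor_self_nonpos_of_orthogonal {x y : Fin 5 → ℝ} (hx : 0 < lor 𝐉 x x) (hx3 : 0 < x 3)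
    (hxy : lor 𝐉 x y = 0) : lor 𝐉 y y ≤ 0 := by
  by_cases hy : y = 0
  · rw [hy, lor_zero_left]
  · exact (lor_self_neg_of_orthogonal hx hx3 hxy hy).le

theorem exists_unit_orthogonal {x : Fin 5 → ℝ} (hx : 0 < lor 𝐉 x x) (hx3 : 0 < x 3)
    (n : Fin 5 → ℝ) : ∃ g, lor 𝐉 x g = 0 ∧ lor 𝐉 n g = 0 ∧ lor 𝐉 g g = -1 := by
  let φ : (Fin 5 → ℝ) →ₗ[ℝ] ℝ × ℝ :=
    { toFun := fun g => (lor 𝐉 x g, lor 𝐉 n g)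
      map_add' := fun a b => by simp [lor_add_right]
      map_smul' := fun a b => by simp [lor_smul_right] }
  obtain ⟨g, hg, hg0⟩ := Submodule.exists_mem_ne_zero_of_ne_bot
    (LinearMap.ker_ne_bot_of_finrank_lt (f := φ) (by simp))
  obtain ⟨h1, h2⟩ : lor 𝐉 x g = 0 ∧ lor 𝐉 n g = 0 := by simpa [φ] using hg
  have h3 := lor_self_neg_of_orthogonal hx hx3 h1 hg0
  have h4 : √(-lor 𝐉 g g) * √(-lor 𝐉 g g) = -lor 𝐉 g g := Real.mul_self_sqrt (by linarith)
  have h5 : √(-lor 𝐉 g g) ≠ 0 := (Real.sqrt_pos.2 (by linarith)).ne'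
  refine ⟨(√(-lor 𝐉 g g))⁻¹ • g, by simp [lor_smul_right, h1], by simp [lor_smul_right, h2], ?_⟩
  rw [lor_smul_right, lor_smul_left]
  field_simp
  rw [pow_two, h4, neg_neg]

/-- This is the monotonicity of `a / √(1 + a²)`, the hyperbolic tangent of the signed distance with
sine `a`. -/
theorem mul_sqrt_lt_mul_sqrt {a r : ℝ} (h : a < r) (hr : 0 ≤ r) :
    a * √(1 + r ^ 2) < r * √(1 + a ^ 2) := by
  rcases lt_or_ge a 0 with ha | ha
  · have := mul_neg_of_neg_of_pos ha (Real.sqrt_pos.2 (by positivity : 0 < 1 + r ^ 2))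
    have : 0 ≤ r * √(1 + a ^ 2) := by positivity
    linarith
  · refine lt_of_pow_lt_pow_left₀ 2 (by positivity) ?_
    rw [mul_pow, mul_pow, Real.sq_sqrt (by positivity), Real.sq_sqrt (by positivity)]
    nlinarith

/-- If a point of hyperbolic space is deeper in the half-space of `m` than it is outside of that
of `n`, then the two balls meet. -/
theorem exists_mem_both_balls {m n x : Fin 5 → ℝ} (hm : lor 𝐉 m m = -1) (hn : lor 𝐉 n n = -1)
    (hx : lor 𝐉 x x = 1) (hx3 : 0 < x 3) (hmx : lor 𝐉 m x < 0)
    (h : lor 𝐉 n x + lor 𝐉 m x < 0) :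
    ∃ z, lor 𝐉 z z = 0 ∧ 0 < z 3 ∧ lor 𝐉 m z < 0 ∧ lor 𝐉 n z < 0 := by
  have hx0 : 0 < lor 𝐉 x x := hx ▸ one_pos
  obtain ⟨g, hxg, hng, hg⟩ := exists_unit_orthogonal hx0 hx3 n
  have hgx := (lor_maxwell_comm g x).trans hxg
  have hgn := (lor_maxwell_comm g n).trans hng
  have hxn := lor_maxwell_comm x n
  have hxm := lor_maxwell_comm x m
  set a := lor 𝐉 n x with ha
  set t := -lor 𝐉 m x with ht
  have hmx' : lor 𝐉 m x = -t := by rw [ht, neg_neg]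
  obtain ⟨r, hr0, har, hrt⟩ : ∃ r, 0 ≤ r ∧ a < r ∧ r < t :=
    ⟨(max a 0 + t) / 2, by have := le_max_right a 0; linarith,
      by have := le_max_left a 0; linarith,
      by have : max a 0 < t := max_lt (by linarith) (by linarith)
         linarith⟩
  have ha1 : √(1 + a ^ 2) * √(1 + a ^ 2) = 1 + a ^ 2 := Real.mul_self_sqrt (by positivity)
  have ha0 : √(1 + a ^ 2) ≠ 0 := (Real.sqrt_pos.2 (by positivity)).ne'
  have hr1 : √(1 + r ^ 2) * √(1 + r ^ 2) = 1 + r ^ 2 := Real.mul_self_sqrt (by positivity)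
  -- `f` is the unit tangent vector at `x` with `n = a x + √(1 + a²) f`.
  set f := (√(1 + a ^ 2))⁻¹ • (n - a • x) with hf
  have hxf : lor 𝐉 x f = 0 := by
    simp only [hf, lor_smul_right, lor_sub_right, hx, hxn]; ring
  have hfx := (lor_maxwell_comm f x).trans hxf
  have hff : lor 𝐉 f f = -1 := by
    simp only [hf, lor_smul_right, lor_sub_right, lor_smul_left, lor_sub_left, hx, hxn, hn, ← ha]
    field_simp
    rw [pow_two (√_), ha1]; ring
  have hnf : lor 𝐉 n f = -√(1 + a ^ 2) := by
    simp only [hf, lor_smul_right, lor_sub_right, hn, ← ha]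
    field_simp
    rw [pow_two (√_), ha1]; ring
  have hgf : lor 𝐉 g f = 0 := by
    simp only [hf, lor_smul_right, lor_sub_right, hgn, hgx]; ring
  have hfg := (lor_maxwell_comm f g).trans hgf
  have hfm := lor_maxwell_comm f m
  -- Remove from `m` its components along `x` and `f`; the norm of the rest is `(m · f)² - 1 - t²`,
  -- and it is nonpositive since the rest is orthogonal to `x`.
  have hmf : lor 𝐉 m f ≤ √(1 + t ^ 2) := by
    refine Real.le_sqrt_of_sq_le ?_
    have := lor_self_nonpos_of_orthogonal (y := m + t • x + lor 𝐉 m f • f) hx0 hx3 (by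
      simp only [lor_add_right, lor_smul_right, hxf, hxm, hx, hmx']; ring)
    simp only [lor_add_right, lor_smul_right, lor_add_left, lor_smul_left, hxf, hxm, hx, hmx', hfm,
      hff, hm, hfx] at this
    nlinarith
  -- The candidates are the null vectors `√(1 + r²) x + r f ± g`. As `g` is orthogonal to `n`, both
  -- signs lie in the ball of `n`.
  have hz : ∀ e : ℝ, e * e = 1 →
      lor 𝐉 (√(1 + r ^ 2) • x + r • f + e • g) (√(1 + r ^ 2) • x + r • f + e • g) = 0 ∧
      0 < (√(1 + r ^ 2) • x + r • f + e • g) 3 ∧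
      lor 𝐉 n (√(1 + r ^ 2) • x + r • f + e • g) < 0 := by
    intro e he
    have h1 : lor 𝐉 (√(1 + r ^ 2) • x + r • f + e • g) (√(1 + r ^ 2) • x + r • f + e • g) = 0 := by
      simp only [lor_add_right, lor_smul_right, lor_add_left, lor_smul_left, hx, hff, hg, hxf, hfx,
        hxg, hgx, hfg, hgf]
      linear_combination hr1 - he
    refine ⟨h1, (lor_pos_iff hx0 hx3 h1.ge).1 ?_, ?_⟩
    · simp only [lor_add_left, lor_smul_left, hx, hfx, hgx]
      have : 0 < √(1 + r ^ 2) := by positivity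
      linarith
    · simp only [lor_add_right, lor_smul_right, hng, hnf, ← ha]
      have := mul_sqrt_lt_mul_sqrt har hr0
      linarith
  -- In the sum over the two signs the unknown `m · g` cancels, so at least one of them lies in the
  -- ball of `m`.
  have hsum : lor 𝐉 m (√(1 + r ^ 2) • x + r • f + (1 : ℝ) • g) +
      lor 𝐉 m (√(1 + r ^ 2) • x + r • f + (-1 : ℝ) • g) < 0 := by
    simp only [lor_add_right, lor_smul_right, hmx']
    have := mul_sqrt_lt_mul_sqrt hrt (by linarith)
    have := mul_le_mul_of_nonneg_left hmf hr0
    linarith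
  rcases lt_or_ge (lor 𝐉 m (√(1 + r ^ 2) • x + r • f + (1 : ℝ) • g)) 0 with h' | h'
  · obtain ⟨h1, h2, h3⟩ := hz 1 (by norm_num)
    exact ⟨_, h1, h2, h', h3⟩
  · obtain ⟨h1, h2, h3⟩ := hz (-1) (by norm_num)
    exact ⟨_, h1, h2, by linarith, h3⟩

/-- A half-space contains points of any depth. -/
theorem exists_deep_point {m : Fin 5 → ℝ} (hm : lor 𝐉 m m = -1) {D : Fin 5 → ℝ}
    (hD : 0 < lor 𝐉 D D) (hD3 : 0 < D 3) (t : ℝ) :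
    ∃ x, lor 𝐉 x x = 1 ∧ 0 < x 3 ∧ lor 𝐉 m x = -t := by
  have hDm := lor_maxwell_comm D m
  set b := lor 𝐉 m D
  -- Project `D` to the hyperplane of `m`, where it remains timelike; the point sought lies on the
  -- geodesic from there in direction `m`.
  have hqm : lor 𝐉 m (D + b • m) = 0 := by
    simp only [lor_add_right, lor_smul_right, hm]; ring
  have hqq : lor 𝐉 (D + b • m) (D + b • m) = lor 𝐉 D D + b ^ 2 := by
    simp only [lor_add_right, lor_smul_right, lor_add_left, lor_smul_left, hm, hDm]; ring
  have hqD : 0 < lor 𝐉 (D + b • m) D := by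
    have : lor 𝐉 (D + b • m) D = lor 𝐉 D D + b ^ 2 := by
      rw [lor_add_left, lor_smul_left]; ring
    rw [this]; positivity
  set q := D + b • m
  have hq : 0 < lor 𝐉 q q := by rw [hqq]; positivity
  have hq3 := (lor_pos_iff hD hD3 hq.le).1 hqD
  have hmq := (lor_maxwell_comm q m).trans hqm
  have h1 : √(1 + t ^ 2) * √(1 + t ^ 2) = 1 + t ^ 2 := Real.mul_self_sqrt (by positivity)
  have h2 : √(lor 𝐉 q q) * √(lor 𝐉 q q) = lor 𝐉 q q := Real.mul_self_sqrt hq.le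
  have h3 : 0 < √(lor 𝐉 q q) := Real.sqrt_pos.2 hq
  have hx : lor 𝐉 (t • m + (√(1 + t ^ 2) * (√(lor 𝐉 q q))⁻¹) • q)
      (t • m + (√(1 + t ^ 2) * (√(lor 𝐉 q q))⁻¹) • q) = 1 := by
    simp only [lor_add_right, lor_smul_right, lor_add_left, lor_smul_left, hm, hmq, hqm]
    field_simp
    linear_combination lor 𝐉 q q * h1 - (1 + t ^ 2) * h2
  refine ⟨t • m + (√(1 + t ^ 2) * (√(lor 𝐉 q q))⁻¹) • q, hx,
    (lor_pos_iff hq hq3 (by rw [hx]; exact zero_le_one)).1 ?_, ?_⟩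
  · simp only [lor_add_left, lor_smul_left, hqm, mul_zero, zero_add]
    positivity
  · simp only [lor_add_right, lor_smul_right, hm, hqm]; ring

/-! ### The orbit of the chamber covers hyperbolic space -/

/-- A point in the interior of the chamber. -/
def chamberPoint : Fin 5 → ℝ := ![1, 3, 4, 6, 5]

/-- The margin `1 / 2`, rather than bare positivity, makes the orbit of `chamberPoint` uniformly
discrete. -/
theorem half_le_lor_node_chamberPoint (i : Fin 5) : 1 / 2 ≤ lor 𝐉 (node i) chamberPoint := by
  have h := lt_sqrt_three
  fin_cases i
  · exact le_of_le_of_eq (by simp [chamberPoint]; norm_num) (lor_node_zero _).symm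
  · exact le_of_le_of_eq (by simp [chamberPoint]; norm_num) (lor_node_one _).symm
  · exact le_of_le_of_eq (by simp [chamberPoint]; norm_num) (lor_node_two _).symm
  · exact le_of_le_of_eq (by simp [chamberPoint]; linarith) (lor_node_three _).symm
  · exact le_of_le_of_eq (by simp [chamberPoint]; linarith) (lor_node_four _).symm

theorem lor_node_chamberPoint_nonneg (i : Fin 5) : 0 ≤ lor 𝐉 (node i) chamberPoint :=
  le_trans (by norm_num) (half_le_lor_node_chamberPoint i)

theorem chamberPoint_pos (i : Fin 5) : 0 < chamberPoint i := by
  fin_cases i <;> simp [chamberPoint]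

theorem lor_self_pos_of_chamber {x : Fin 5 → ℝ} (hx : ∀ i, 0 < x i)
    (h : ∀ i, 0 < lor 𝐉 (node i) x) : 0 < lor 𝐉 x x := by
  rw [lor_eq_sum_left]
  exact Finset.sum_pos (fun i _ => mul_pos (hx i) (h i)) Finset.univ_nonempty

theorem lor_self_chamberPoint_pos : 0 < lor 𝐉 chamberPoint chamberPoint :=
  lor_self_pos_of_chamber chamberPoint_pos fun i =>
    lt_of_lt_of_le (by norm_num) (half_le_lor_node_chamberPoint i)

theorem isChamberVector_chamberPoint : IsChamberVector 𝐉 chamberPoint :=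
  ⟨lor_self_chamberPoint_pos, lor_node_chamberPoint_nonneg⟩

/-- A reflection cannot exchange the two sheets: the pairing of `y` with its image is `y · y + (αᵢ ·
y)² > 0`. -/
theorem wordMap_three_pos (L : List (Fin 5)) {x : Fin 5 → ℝ} (hx : 0 < lor 𝐉 x x)
    (hx3 : 0 < x 3) : 0 < wordMap 𝐉 L x 3 := by
  have hJ := isCoxeterGram_maxwellGram
  induction L with
  | nil => exact hx3
  | cons i L ih =>
    rw [wordMap_cons, Module.End.mul_apply]
    have hy : 0 < lor 𝐉 (wordMap 𝐉 L x) (wordMap 𝐉 L x) := by rwa [hJ.lor_wordMap]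
    refine (lor_pos_iff hy ih (by rw [hJ.lor_refl]; exact hy.le)).1 ?_
    rw [refl_apply, lor_add_left, lor_smul_left]
    exact add_pos_of_pos_of_nonneg hy (mul_self_nonneg _)

/-- The image of the point `p` lies above `p + (αᵢ · p) αᵢ` for some `i`, and pairing with the
dominant `p` gains at least `(αᵢ · p)² ≥ 1 / 4`. -/
theorem lor_chamberPoint_wordMap_ge {L : List (Fin 5)} (hL : wordMap 𝐉 L ≠ 1) :
    lor 𝐉 chamberPoint chamberPoint + 1 / 4 ≤ lor 𝐉 chamberPoint (wordMap 𝐉 L chamberPoint) := by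
  have hJ := isCoxeterGram_maxwellGram
  obtain ⟨i, L', h1, h2, -⟩ := exists_first_letter hL
  have h3 := hJ.wordMap_ge_of_reduced i L' h2 chamberPoint lor_node_chamberPoint_nonneg
  rw [h1] at h3
  have h4 : 0 ≤ lor 𝐉 (wordMap 𝐉 L chamberPoint - refl 𝐉 i chamberPoint) chamberPoint := by
    rw [lor_eq_sum_left]
    exact Finset.sum_nonneg fun k _ =>
      mul_nonneg (sub_nonneg.2 (h3 k)) (lor_node_chamberPoint_nonneg k)
  rw [lor_sub_left, refl_apply, lor_add_left, lor_smul_left, lor_maxwell_comm _ chamberPoint] at h4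
  nlinarith [half_le_lor_node_chamberPoint i]

theorem lor_sub_orbit_le {L M : List (Fin 5)} (h : wordMap 𝐉 L chamberPoint ≠
    wordMap 𝐉 M chamberPoint) :
    lor 𝐉 (wordMap 𝐉 L chamberPoint - wordMap 𝐉 M chamberPoint)
      (wordMap 𝐉 L chamberPoint - wordMap 𝐉 M chamberPoint) ≤ -(1 / 2) := by
  have hJ := isCoxeterGram_maxwellGram
  have h1 : wordMap 𝐉 (L.reverse ++ M) ≠ 1 := by
    intro h1
    refine h ?_
    conv_lhs => rw [← Module.End.one_apply (R := ℝ) chamberPoint, ← h1, wordMap_append,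
      Module.End.mul_apply, ← Module.End.mul_apply, hJ.wordMap_mul_reverse, Module.End.one_apply]
  have h2 := lor_chamberPoint_wordMap_ge h1
  rw [wordMap_append, Module.End.mul_apply, ← hJ.lor_wordMap_left] at h2
  simp only [lor_sub_left, lor_sub_right, hJ.lor_wordMap]
  rw [lor_maxwell_comm (wordMap 𝐉 M chamberPoint)]
  linarith

theorem continuous_lor_self : Continuous fun v : Fin 5 → ℝ => lor 𝐉 v v := by
  simp only [lor_eq_five]
  fun_prop

/-- Below a bounded height over a point, the closed solid light cone is bounded. -/
theorem isBounded_lor_le {x : Fin 5 → ℝ} (hx : 0 < lor 𝐉 x x) (hx3 : 0 < x 3) (M : ℝ) :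
    Bornology.IsBounded {v | 0 ≤ lor 𝐉 v v ∧ 0 ≤ v 3 ∧ lor 𝐉 x v ≤ M} := by
  have hq : 1 ≤ 1 + √3 := by simp
  have hS : √(∑ i, spacePart x i ^ 2) < (1 + √3) * x 3 := by
    rw [Real.sqrt_lt' (by positivity)]
    have := two_mul_lor x x
    simp only [← pow_two] at this
    linarith
  set A := (1 + √3) * x 3
  set S := √(∑ i, spacePart x i ^ 2)
  -- From `(A - S) B ≤ 2 x · v` follows a bound for the time part `B` of `v`. The forms in
  -- `spacePart v` are then at most `B` in size, and solving for the coordinates costs a factor of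
  -- at most 2.
  refine (Metric.isBounded_closedBall (x := (0 : Fin 5 → ℝ)) (r := 2 * (2 * M / (A - S)))).subset ?_
  rintro v ⟨hv, hv3, hxv⟩
  have hvv := two_mul_lor v v
  have hxv2 := two_mul_lor x v
  simp only [← pow_two] at hvv
  have hB0 : 0 ≤ (1 + √3) * v 3 := by positivity
  have hBv : v 3 ≤ (1 + √3) * v 3 := le_mul_of_one_le_left hv3 hq
  have hBs : √3 * v 3 ≤ (1 + √3) * v 3 := by linarith
  have hBs0 : 0 ≤ √3 * v 3 := by positivity
  set B := (1 + √3) * v 3 with hBdef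
  have hT : ∑ i, spacePart v i ^ 2 ≤ B ^ 2 := by linarith
  have cs : ∑ i, spacePart x i * spacePart v i ≤ S * B := by
    refine (Real.sum_mul_le_sqrt_mul_sqrt _ _ _).trans ?_
    exact mul_le_mul_of_nonneg_left (Real.sqrt_le_iff.2 ⟨hB0, hT⟩) (Real.sqrt_nonneg _)
  have hB : B ≤ 2 * M / (A - S) := by
    rw [le_div_iff₀ (by linarith)]
    linarith
  have hi : ∀ i, |spacePart v i| ≤ B := fun i => abs_le_of_sq_le_sq
    ((Finset.single_le_sum (f := fun i => spacePart v i ^ 2) (fun _ _ => sq_nonneg _)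
      (Finset.mem_univ i)).trans hT) hB0
  have h0 := abs_le.1 (hi 0)
  have h1 := abs_le.1 (hi 1)
  have h2 := abs_le.1 (hi 2)
  have h3 := abs_le.1 (hi 3)
  simp only [spacePart, Matrix.cons_val, ← hBdef] at h0 h1 h2 h3
  rw [mem_closedBall_zero_iff]
  refine (pi_norm_le_iff_of_nonneg (by linarith)).2 fun i => ?_
  rw [Real.norm_eq_abs, abs_le]
  fin_cases i <;> constructor <;> simp <;> linarith

/-- Otherwise a bounded sequence of distinct orbit points has a convergent subsequence, whose
successive differences tend to `0` although their norms are at most `-1 / 2`. -/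
theorem finite_orbit_lor_le {x : Fin 5 → ℝ} (hx : 0 < lor 𝐉 x x) (hx3 : 0 < x 3) (M : ℝ) :
    {v | ∃ L, v = wordMap 𝐉 L chamberPoint ∧ lor 𝐉 x v ≤ M}.Finite := by
  have hJ := isCoxeterGram_maxwellGram
  by_contra hinf
  let u := Set.Infinite.natEmbedding _ hinf
  obtain ⟨a, -, φ, hφ, ha⟩ := tendsto_subseq_of_bounded (isBounded_lor_le hx hx3 M)
    (x := fun n => (u n : Fin 5 → ℝ)) (fun n => by
      obtain ⟨L, h1, h2⟩ := (u n).2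
      rw [h1] at h2 ⊢
      exact ⟨by rw [hJ.lor_wordMap]; exact lor_self_chamberPoint_pos.le,
        (wordMap_three_pos L lor_self_chamberPoint_pos (chamberPoint_pos 3)).le, h2⟩)
  have hd : Filter.Tendsto (fun n => (u (φ (n + 1)) : Fin 5 → ℝ) - u (φ n)) Filter.atTop
      (nhds (a - a)) := (ha.comp (Filter.tendsto_add_atTop_nat 1)).sub ha
  have hl := (continuous_lor_self.tendsto _).comp hd
  rw [sub_self, lor_zero_left] at hl
  have : (0 : ℝ) ≤ -(1 / 2) := le_of_tendsto hl (Filter.Eventually.of_forall fun n => by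
    obtain ⟨L, h1, -⟩ := (u (φ (n + 1))).2
    obtain ⟨L', h1', -⟩ := (u (φ n)).2
    have hne : (u (φ (n + 1)) : Fin 5 → ℝ) ≠ u (φ n) := fun h =>
      (hφ (Nat.lt_succ_self n)).ne' (u.injective (Subtype.ext h))
    simp only [Function.comp_apply]
    rw [h1, h1'] at hne ⊢
    exact lor_sub_orbit_le hne)
  norm_num at this

/-- Every point of hyperbolic space can be moved into the chamber. -/
theorem exists_wordMap_mem_chamber {x : Fin 5 → ℝ} (hx : 0 < lor 𝐉 x x) (hx3 : 0 < x 3) :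
    ∃ L, ∀ i, 0 ≤ lor 𝐉 (node i) (wordMap 𝐉 L x) := by
  have hJ := isCoxeterGram_maxwellGram
  -- Minimal pairing with `x` means the nearest orbit point. If `x` were beyond a wall of the
  -- corresponding chamber, reflection in that wall would give a nearer one.
  obtain ⟨v, ⟨L, rfl, hLle⟩, hmin⟩ := Set.exists_min_image _ (lor 𝐉 x)
    (finite_orbit_lor_le hx hx3 (lor 𝐉 x chamberPoint)) ⟨chamberPoint, [], rfl, le_rfl⟩
  refine ⟨L.reverse, fun i => ?_⟩
  by_contra! h
  have h1 : lor 𝐉 x (wordMap 𝐉 (L ++ [i]) chamberPoint) < lor 𝐉 x (wordMap 𝐉 L chamberPoint) := by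
    rw [wordMap_append, wordMap_singleton, Module.End.mul_apply, refl_apply, map_add, map_smul,
      lor_add_right, lor_smul_right, lor_maxwell_comm x (wordMap 𝐉 L (node i)),
      hJ.lor_wordMap_left]
    have := half_le_lor_node_chamberPoint i
    nlinarith
  exact h1.not_ge (hmin _ ⟨_, rfl, h1.le.trans hLle⟩)

/-! ### Weights and spheres -/

/-- The inverse of the Gram matrix. -/
def weightMatrix : Matrix (Fin 5) (Fin 5) ℝ :=
  !![-1 / 2, 0, (√3 - 1) / 4, (√3 - 1) / 2, (3 - √3) / 4;
     0, 0, (√3 - 1) / 2, √3 - 1, (3 - √3) / 2;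
     (√3 - 1) / 4, (√3 - 1) / 2, (√3 - 2) / 4, 1 / 2, (2 * √3 - 1) / 4;
     (√3 - 1) / 2, √3 - 1, 1 / 2, 2 - √3, (3 * √3 - 4) / 2;
     (3 - √3) / 4, (3 - √3) / 2, (2 * √3 - 1) / 4, (3 * √3 - 4) / 2, (10 - 5 * √3) / 4]

theorem maxwellGram_mul_weightMatrix : 𝐉 * weightMatrix = 1 := by
  have h := sqrt_three_mul_self
  ext i j
  rw [Matrix.mul_apply, Fin.sum_univ_five]
  fin_cases i <;> fin_cases j <;> simp [maxwellGram, weightMatrix] <;>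
    linarith

theorem weight_eq (i : Fin 5) : weight 𝐉 i = weightMatrix i := by
  rw [weight, Matrix.inv_eq_right_inv maxwellGram_mul_weightMatrix]

theorem lor_weight_left (i : Fin 5) (x : Fin 5 → ℝ) : lor 𝐉 (weight 𝐉 i) x = x i := by
  have h : weightMatrix.mulVec (Matrix.mulVec 𝐉 x) = x := by
    rw [Matrix.mulVec_mulVec, mul_eq_one_comm.1 maxwellGram_mul_weightMatrix, Matrix.one_mulVec]
  rw [weight_eq]
  exact congrFun h i

theorem lor_node_weight (k i : Fin 5) :
    lor 𝐉 (node k) (weight 𝐉 i) = if i = k then 1 else 0 := by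
  rw [lor_maxwell_comm, lor_weight_left, node, Pi.single_apply]

theorem lor_node_weight_nonneg (i k : Fin 5) : 0 ≤ lor 𝐉 (node k) (weight 𝐉 i) := by
  rw [lor_node_weight]; split_ifs <;> norm_num

/-- The norms are the diagonal entries of `weightMatrix`: `-1/2`, `0`, `(√3 - 2)/4`, `2 - √3`, `(10
- 5√3)/4`. -/
theorem lor_weight_neg_iff (i : Fin 5) :
    lor 𝐉 (weight 𝐉 i) (weight 𝐉 i) < 0 ↔ i = 0 ∨ i = 2 := by
  have h1 := lt_sqrt_three
  have h2 := sqrt_three_lt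
  rw [lor_weight_left, weight_eq]
  fin_cases i <;> simp [weightMatrix] <;> linarith

/-- The factor that normalizes a weight. -/
def weightScale (i : Fin 5) : ℝ := (len 𝐉 (weight 𝐉 i))⁻¹

theorem weightScale_pos {i : Fin 5} (hi : i = 0 ∨ i = 2) : 0 < weightScale i :=
  inv_pos.2 (Real.sqrt_pos.2 (neg_pos.2 ((lor_weight_neg_iff i).2 hi)))

theorem weightScale_mul_self {i : Fin 5} (hi : i = 0 ∨ i = 2) :
    weightScale i * weightScale i * weight 𝐉 i i = -1 := by
  have h := (lor_weight_neg_iff i).2 hi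
  have h2 : len 𝐉 (weight 𝐉 i) * len 𝐉 (weight 𝐉 i) = -lor 𝐉 (weight 𝐉 i) (weight 𝐉 i) :=
    Real.mul_self_sqrt (by linarith)
  rw [lor_weight_left] at h h2
  rw [weightScale, ← mul_inv, h2, inv_neg, neg_mul, inv_mul_cancel₀ h.ne]

theorem weight_zero_zero : weight 𝐉 0 0 = -1 / 2 := by rw [weight_eq]; simp [weightMatrix]

theorem weight_two_zero : weight 𝐉 2 0 = (√3 - 1) / 4 := by rw [weight_eq]; simp [weightMatrix]

theorem weight_zero_two : weight 𝐉 0 2 = (√3 - 1) / 4 := by rw [weight_eq]; simp [weightMatrix]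

theorem weight_two_two : weight 𝐉 2 2 = (√3 - 2) / 4 := by rw [weight_eq]; simp [weightMatrix]

theorem weightScale_zero_mul_zero : weightScale 0 * weightScale 0 = 2 := by
  have := weightScale_mul_self (.inl rfl)
  rw [weight_zero_zero] at this
  linarith

theorem weightScale_two_mul_two : weightScale 2 * weightScale 2 = 8 + 4 * √3 := by
  have := weightScale_mul_self (.inr rfl)
  rw [weight_two_two] at this
  linear_combination (-(8 + 4 * √3)) * this +
    (weightScale 2 * weightScale 2) * sqrt_three_mul_self

theorem weightScale_zero_mul_two : weightScale 0 * weightScale 2 = 2 + 2 * √3 := by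
  have h0 := weightScale_pos (i := 0) (.inl rfl)
  have h2 := weightScale_pos (i := 2) (.inr rfl)
  refine (mul_self_inj (by positivity) (by positivity)).1 ?_
  linear_combination weightScale 2 * weightScale 2 * weightScale_zero_mul_zero +
    2 * weightScale_two_mul_two - 4 * sqrt_three_mul_self

theorem normalize_wordMap_weight (L : List (Fin 5)) (i : Fin 5) :
    normalize 𝐉 (wordMap 𝐉 L (weight 𝐉 i)) = weightScale i • wordMap 𝐉 L (weight 𝐉 i) := by
  rw [normalize, len, isCoxeterGram_maxwellGram.lor_wordMap]; rfl

theorem mem_graphPacking_iff {x : Fin 5 → ℝ} : x ∈ graphPacking 𝐉 ↔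
    ∃ L i, (i = 0 ∨ i = 2) ∧ x = weightScale i • wordMap 𝐉 L (weight 𝐉 i) := by
  constructor
  · rintro ⟨γ, hγ, i, hi, rfl⟩
    obtain ⟨L, hL⟩ := isCoxeterGram_maxwellGram.exists_word hγ
    exact ⟨L, i, (lor_weight_neg_iff i).1 hi, by rw [hL, normalize_wordMap_weight]⟩
  · rintro ⟨L, i, hi, rfl⟩
    obtain ⟨γ, hγ, h⟩ := isCoxeterGram_maxwellGram.exists_mem_weylGroup L
    exact ⟨γ, hγ, i, (lor_weight_neg_iff i).2 hi, by rw [h, normalize_wordMap_weight]⟩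

theorem smul_wordMap_mem {i : Fin 5} (hi : i = 0 ∨ i = 2) (L : List (Fin 5)) :
    weightScale i • wordMap 𝐉 L (weight 𝐉 i) ∈ graphPacking 𝐉 :=
  mem_graphPacking_iff.2 ⟨L, i, hi, rfl⟩

theorem lor_self_of_mem {n : Fin 5 → ℝ} (hn : n ∈ graphPacking 𝐉) : lor 𝐉 n n = -1 := by
  obtain ⟨L, i, hi, rfl⟩ := mem_graphPacking_iff.1 hn
  rw [lor_smul_left, lor_smul_right, isCoxeterGram_maxwellGram.lor_wordMap, lor_weight_left,
    ← mul_assoc, weightScale_mul_self hi]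

theorem wordMap_mem_graphPacking {n : Fin 5 → ℝ} (hn : n ∈ graphPacking 𝐉) (L : List (Fin 5)) :
    wordMap 𝐉 L n ∈ graphPacking 𝐉 := by
  obtain ⟨M, i, hi, rfl⟩ := mem_graphPacking_iff.1 hn
  rw [map_smul, ← Module.End.mul_apply, ← wordMap_append]
  exact smul_wordMap_mem hi _

/-! ### The spheres form a packing -/

/-- A word either fixes a weight `wᵢ` or raises its `i`-th coordinate by at least one. -/
theorem wordMap_weight_eq_or_le (i : Fin 5) (n : ℕ) : ∀ L : List (Fin 5),
    wordLength 𝐉 (wordMap 𝐉 L) = n →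
    wordMap 𝐉 L (weight 𝐉 i) = weight 𝐉 i ∨ weight 𝐉 i i + 1 ≤ wordMap 𝐉 L (weight 𝐉 i) i := by
  have hJ := isCoxeterGram_maxwellGram
  induction n using Nat.strong_induction_on with
  | _ n ih =>
  intro L hL
  by_cases h : wordMap 𝐉 L = 1
  · rw [h]; exact .inl rfl
  obtain ⟨k, L', h1, h2, h3⟩ := exists_first_letter h
  have hge := hJ.wordMap_ge_of_reduced k L' h2 (weight 𝐉 i) (lor_node_weight_nonneg i)
  rw [← h1] at hL ⊢
  rw [h2] at hL
  rcases eq_or_ne i k with rfl | hik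
  · right
    refine le_trans (le_of_eq ?_) (hge i)
    rw [refl_apply, lor_node_weight, if_pos rfl]
    simp [node]
  · rw [wordMap_cons, Module.End.mul_apply]
    rcases ih _ (by omega) L' h3 with h4 | h4
    · left
      rw [h4, refl_apply, lor_node_weight, if_neg hik, zero_smul, add_zero]
    · right
      simpa [refl_apply, node, Pi.single_apply, hik] using h4

/-- After moving the first sphere to `wᵢ`, the pairing is a scaled coordinate `i` of some `γ wⱼ`.
For `i ≠ j` its minimum, at `wⱼ`, is exactly `1`, so tangency occurs. For `i = j` it is at least `-1
+ weightScale i ^ 2`, where the square is `2` or `8 + 4√3`. -/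
theorem one_le_lor_of_mem {n n' : Fin 5 → ℝ} (hn : n ∈ graphPacking 𝐉) (hn' : n' ∈ graphPacking 𝐉)
    (hne : n ≠ n') : 1 ≤ lor 𝐉 n n' := by
  have hJ := isCoxeterGram_maxwellGram
  obtain ⟨L, i, hi, rfl⟩ := mem_graphPacking_iff.1 hn
  obtain ⟨M, j, hj, rfl⟩ := mem_graphPacking_iff.1 hn'
  have hi0 := weightScale_pos hi
  have hj0 := weightScale_pos hj
  rw [lor_smul_left, lor_smul_right, hJ.lor_wordMap_left, lor_weight_left, ← Module.End.mul_apply,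
    ← wordMap_append, ← mul_assoc]
  have hge := hJ.le_wordMap (L.reverse ++ M) (weight 𝐉 j) (lor_node_weight_nonneg j)
  have h3 := sqrt_three_mul_self
  have h3' := lt_sqrt_three
  by_cases hij : i = j
  · subst hij
    rcases wordMap_weight_eq_or_le i _ (L.reverse ++ M) rfl with h | h
    · refine absurd ?_ hne
      conv_lhs => rw [← h, wordMap_append, Module.End.mul_apply, ← Module.End.mul_apply,
        hJ.wordMap_mul_reverse, Module.End.one_apply]
    · refine le_trans ?_ (mul_le_mul_of_nonneg_left h (by positivity))
      rw [mul_add, weightScale_mul_self hi, mul_one]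
      rcases hi with rfl | rfl
      · rw [weightScale_zero_mul_zero]; norm_num
      · rw [weightScale_two_mul_two]; linarith
  · refine le_trans (le_of_eq ?_) (mul_le_mul_of_nonneg_left (hge i) (by positivity))
    rcases hi with rfl | rfl <;> rcases hj with rfl | rfl
    · exact absurd rfl hij
    · rw [weightScale_zero_mul_two, weight_two_zero]; linear_combination (-1 / 2) * h3
    · rw [mul_comm (weightScale 2), weightScale_zero_mul_two, weight_zero_two]
      linear_combination (-1 / 2) * h3
    · exact absurd rfl hij

theorem lor_weight_chamberPoint_pos (L : List (Fin 5)) (i : Fin 5) :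
    0 < lor 𝐉 (wordMap 𝐉 L (weight 𝐉 i)) chamberPoint := by
  have hge := isCoxeterGram_maxwellGram.le_wordMap L (weight 𝐉 i) (lor_node_weight_nonneg i)
  refine (chamberPoint_pos i).trans_le ?_
  rw [← lor_weight_left i chamberPoint, lor_eq_sum_left, lor_eq_sum_left]
  exact Finset.sum_le_sum fun k _ =>
    mul_le_mul_of_nonneg_right (hge k) (lor_node_chamberPoint_nonneg k)

/-- The sum has norm `2 (n · n') - 2 ≥ 0`. It is forward because an image of `chamberPoint` lies on
the positive side of both spheres. A common point of the two balls would pair negatively with it. -/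
theorem add_three_pos_of_mem {n n' : Fin 5 → ℝ} (hn : n ∈ graphPacking 𝐉)
    (hn' : n' ∈ graphPacking 𝐉) (hne : n ≠ n') :
    0 ≤ lor 𝐉 (n + n') (n + n') ∧ 0 < (n + n') 3 := by
  have hJ := isCoxeterGram_maxwellGram
  have h0 : 0 ≤ lor 𝐉 (n + n') (n + n') := by
    have := one_le_lor_of_mem hn hn' hne
    rw [lor_add_left, lor_add_right, lor_add_right, lor_self_of_mem hn, lor_self_of_mem hn',
      lor_maxwell_comm n' n]
    linarith
  refine ⟨h0, ?_⟩
  obtain ⟨L, i, hi, rfl⟩ := mem_graphPacking_iff.1 hn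
  obtain ⟨M, j, hj, rfl⟩ := mem_graphPacking_iff.1 hn'
  refine (lor_pos_iff (D := wordMap 𝐉 L chamberPoint)
    (by rw [hJ.lor_wordMap]; exact lor_self_chamberPoint_pos)
    (wordMap_three_pos L lor_self_chamberPoint_pos (chamberPoint_pos 3)) h0).1 ?_
  rw [lor_add_left, lor_smul_left, lor_smul_left, hJ.lor_wordMap, lor_maxwell_comm _ (wordMap _ _ _),
    hJ.lor_wordMap_left, lor_maxwell_comm chamberPoint, ← Module.End.mul_apply, ← wordMap_append]
  exact add_pos (mul_pos (weightScale_pos hi) (lor_weight_chamberPoint_pos [] i))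
    (mul_pos (weightScale_pos hj) (lor_weight_chamberPoint_pos _ j))

theorem isPacking_graphPacking {D : Fin 5 → ℝ} (hD : IsChamberVector 𝐉 D) :
    IsPacking 𝐉 D (graphPacking 𝐉) := by
  refine ⟨⟨1, one_pos, fun n hn => ⟨lor_self_of_mem hn, fun n' hn' hne =>
    one_le_lor_of_mem hn hn' hne⟩⟩, fun n hn n' hn' hne => Set.disjoint_left.2 ?_⟩
  rintro z ⟨hz, h1⟩ ⟨-, h2⟩
  obtain ⟨hz0, hz3⟩ := (mem_lightCone_iff hD).1 hz
  obtain ⟨h3, h4⟩ := add_three_pos_of_mem hn hn' hne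
  have := lor_nonneg_of_forward h3 hz0.ge h4.le hz3.le
  rw [lor_add_left] at this
  linarith

/-! ### Maximality -/

/-- The points of the chamber outside of the half-spaces of `w₀` and `w₂` are close to the
hyperplane of `w₀`. -/
theorem sq_zero_le_of_chamber {y : Fin 5 → ℝ} (hy : ∀ i, 0 ≤ lor 𝐉 (node i) y) (h0 : 0 ≤ y 0)
    (h2 : 0 ≤ y 2) : y 0 ^ 2 ≤ 4 * lor 𝐉 y y := by
  have hs := lt_sqrt_three
  have hs' := sqrt_three_lt
  have h3 := sqrt_three_mul_self
  have hW : weightMatrix.mulVec (Matrix.mulVec 𝐉 y) = y := by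
    rw [Matrix.mulVec_mulVec, mul_eq_one_comm.1 maxwellGram_mul_weightMatrix, Matrix.one_mulVec]
  have hsum := lor_eq_sum_left 𝐉 y y
  have e : ∀ i, y i = ∑ k, weightMatrix i k * lor 𝐉 (node k) y := fun i => by
    simp_rw [lor_node_left]; exact (congrFun hW i).symm
  have e0 := e 0
  have e1 := e 1
  have e2 := e 2
  have e3 := e 3
  have e4 := e 4
  clear e
  simp only [Fin.sum_univ_five, weightMatrix, Matrix.of_apply, Matrix.cons_val] at e0 e1 e2 e3 e4
  rw [Fin.sum_univ_five] at hsum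
  have a0 := hy 0
  have a1 := hy 1
  have a2 := hy 2
  have a3 := hy 3
  have a4 := hy 4
  generalize lor 𝐉 (node 0) y = A0 at *
  generalize lor 𝐉 (node 1) y = A1 at *
  generalize lor 𝐉 (node 2) y = A2 at *
  generalize lor 𝐉 (node 3) y = A3 at *
  generalize lor 𝐉 (node 4) y = A4 at *
  -- The multiplier `√3 + 1` of `y 2` is the one that cancels both `A0` and `A2`.
  have b0 : y 0 ≤ A1 + 2 * A3 + 2 * A4 := by
    have : y 0 + (√3 + 1) * y 2 = A1 + √3 * A3 + 2 * A4 := by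
      rw [e0, e2]
      linear_combination (A0 / 4 + A1 / 2 + A2 / 4 + A4 / 2) * h3
    have h5 : 0 ≤ (√3 + 1) * y 2 := by positivity
    have h6 : 0 ≤ (2 - √3) * A3 := mul_nonneg (by linarith) a3
    linarith
  have b1 : 2 * y 0 ≤ y 1 := by rw [e0, e1]; linarith
  have p1 : 0 ≤ √3 - 1 := by linarith
  have p2 : 0 ≤ 3 * √3 - 4 := by linarith
  have p3 : 0 ≤ 2 - √3 := by linarith
  have b3 : y 0 ≤ 2 * y 3 := by
    have : 2 * y 3 - y 0 = (√3 - 1 + 1 / 2) * A0 + 2 * (√3 - 1) * A1 + (5 - √3) / 4 * A2 +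
        (9 - 5 * √3) / 2 * A3 + (13 * √3 - 19) / 4 * A4 := by rw [e3, e0]; ring
    have p4 : 0 ≤ 5 - √3 := by linarith
    have p5 : 0 ≤ 9 - 5 * √3 := by linarith
    have p6 : 0 ≤ 13 * √3 - 19 := by linarith
    have : 0 ≤ 2 * y 3 - y 0 := by rw [this]; positivity
    linarith
  have b4 : y 0 ≤ 2 * y 4 := by
    have : 2 * y 4 - y 0 = (4 - √3) / 2 * A0 + (3 - √3) * A1 + (3 * √3 - 1) / 4 * A2 +
        (5 * √3 - 7) / 2 * A3 + (17 - 9 * √3) / 4 * A4 := by rw [e4, e0]; ring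
    have p4 : 0 ≤ 4 - √3 := by linarith
    have p5 : 0 ≤ 3 - √3 := by linarith
    have p6 : 0 ≤ 3 * √3 - 1 := by linarith
    have p7 : 0 ≤ 5 * √3 - 7 := by linarith
    have p8 : 0 ≤ 17 - 9 * √3 := by linarith
    have : 0 ≤ 2 * y 4 - y 0 := by rw [this]; positivity
    linarith
  -- In `y · y = ∑ yₖ Aₖ` drop the terms `0` and `2`. The rest is at least `y₀ (2 A1 + A3 / 2 + A4 /
  -- 2)`, hence at least `y₀² / 4` by `b0`.
  have c0 := mul_nonneg h0 a0
  have c1 := mul_le_mul_of_nonneg_right b1 a1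
  have c2 := mul_nonneg h2 a2
  have c3 := mul_le_mul_of_nonneg_right b3 a3
  have c4 := mul_le_mul_of_nonneg_right b4 a4
  have c5 := mul_le_mul_of_nonneg_left b0 h0
  have c6 := mul_nonneg h0 a1
  nlinarith

/-- Every point of hyperbolic space is close to a half-space of the packing. -/
theorem exists_mem_lor_lt {x : Fin 5 → ℝ} (hx : lor 𝐉 x x = 1) (hx3 : 0 < x 3) :
    ∃ n ∈ graphPacking 𝐉, lor 𝐉 n x < 5 := by
  obtain ⟨L, hL⟩ := exists_wordMap_mem_chamber (hx ▸ one_pos) hx3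
  have key : ∀ i, lor 𝐉 (weightScale i • wordMap 𝐉 L.reverse (weight 𝐉 i)) x =
      weightScale i * wordMap 𝐉 L x i := fun i => by
    rw [lor_smul_left, isCoxeterGram_maxwellGram.lor_wordMap_left, List.reverse_reverse,
      lor_weight_left]
  have s0 := weightScale_pos (i := 0) (.inl rfl)
  have s2 := weightScale_pos (i := 2) (.inr rfl)
  rcases lt_or_ge (wordMap 𝐉 L x 2) 0 with h2 | h2
  · exact ⟨_, smul_wordMap_mem (.inr rfl) L.reverse, by rw [key]; nlinarith⟩
  refine ⟨_, smul_wordMap_mem (.inl rfl) L.reverse, ?_⟩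
  rw [key]
  rcases lt_or_ge (wordMap 𝐉 L x 0) 0 with h0 | h0
  · nlinarith
  have h := sq_zero_le_of_chamber hL h0 h2
  rw [isCoxeterGram_maxwellGram.lor_wordMap, hx] at h
  -- The square of the pairing is at most `2 * 4 = 8 < 25`.
  refine lt_of_pow_lt_pow_left₀ 2 (by norm_num) ?_
  rw [mul_pow, pow_two (weightScale 0), weightScale_zero_mul_zero]
  linarith

/-- The half-space of `m` has a point of depth `5`, but that point pairs to less than `5` with some
sphere `n` of the packing, so the balls of `m` and `n` meet. -/
theorem isMaximal_graphPacking {D : Fin 5 → ℝ} (hD : IsChamberVector 𝐉 D) :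
    IsMaximal 𝐉 D (graphPacking 𝐉) := by
  rintro ⟨m, hm, hball⟩
  have h1 : √(-lor 𝐉 m m) * √(-lor 𝐉 m m) = -lor 𝐉 m m := Real.mul_self_sqrt (by linarith)
  have h2 : 0 < √(-lor 𝐉 m m) := Real.sqrt_pos.2 (by linarith)
  have hm1 : lor 𝐉 ((√(-lor 𝐉 m m))⁻¹ • m) ((√(-lor 𝐉 m m))⁻¹ • m) = -1 := by
    rw [lor_smul_left, lor_smul_right]
    field_simp
    rw [pow_two, h1, neg_neg]
  obtain ⟨x, hx, hx3, hmx⟩ := exists_deep_point hm1 lor_self_chamberPoint_pos (chamberPoint_pos 3) 5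
  obtain ⟨n, hn, hnx⟩ := exists_mem_lor_lt hx hx3
  obtain ⟨z, hz, hz3, hmz, hnz⟩ := exists_mem_both_balls hm1 (lor_self_of_mem hn) hx hx3
    (by rw [hmx]; norm_num) (by rw [hmx]; linarith)
  rw [lor_smul_left] at hmz
  have hmz' : lor 𝐉 m z < 0 := (pos_iff_neg_of_mul_neg hmz).1 (inv_pos.2 h2)
  exact hnz.not_ge ((hball ⟨(mem_lightCone_iff hD).2 ⟨hz, hz3⟩, hmz'⟩).2 n hn)

/-! ### The Apollonian property -/

/-- The words that map the weights of `clusterWeight` to the spheres of a cluster. -/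
def clusterWord : Fin 5 → List (Fin 5) := ![[], [0], [1, 0], [4, 1, 0], []]

/-- The weights in whose orbits the spheres of the cluster lie. -/
def clusterWeight : Fin 5 → Fin 5 := ![0, 0, 0, 0, 2]

theorem wordMap_zero_weight : wordMap 𝐉 [0] (weight 𝐉 0) = weight 𝐉 0 + node 0 := by
  simp [wordMap_singleton, refl_apply, lor_node_weight]

theorem wordMap_one_zero_weight :
    wordMap 𝐉 [1, 0] (weight 𝐉 0) = weight 𝐉 0 + node 0 + node 1 := by
  rw [wordMap_cons, Module.End.mul_apply, wordMap_zero_weight, refl_apply, lor_add_right,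
    lor_node_weight, lor_node_node]
  simp [maxwellGram]

theorem wordMap_four_one_zero_weight :
    wordMap 𝐉 [4, 1, 0] (weight 𝐉 0) = weight 𝐉 0 + node 0 + node 1 + node 4 := by
  rw [wordMap_cons, Module.End.mul_apply, wordMap_one_zero_weight, refl_apply, lor_add_right,
    lor_add_right, lor_node_weight, lor_node_node, lor_node_node]
  simp [maxwellGram]

/-- The reflections in the nodes `0`, `1`, `4` generate a symmetric group on four letters; it
permutes the first four spheres and fixes `w₂`, which is tangent to `w₀` and so to all four. -/
theorem isCluster_clusterWord : IsCluster 𝐉 fun i =>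
    weightScale (clusterWeight i) • wordMap 𝐉 (clusterWord i) (weight 𝐉 (clusterWeight i)) := by
  have h00 := weightScale_zero_mul_zero
  have h02 := weightScale_zero_mul_two
  have h20 := (mul_comm (weightScale 2) (weightScale 0)).trans h02
  have h22 := weightScale_two_mul_two
  have h3 := sqrt_three_mul_self
  refine ⟨1, one_pos, fun i j => ?_⟩
  have j01 : 𝐉 0 1 = 1 := rfl
  have j10 : 𝐉 1 0 = 1 := rfl
  have j04 : 𝐉 0 4 = 0 := rfl
  have j40 : 𝐉 4 0 = 0 := rfl
  have j14 : 𝐉 1 4 = 1 := rfl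
  have j41 : 𝐉 4 1 = 1 := rfl
  have hnil : ∀ x, wordMap 𝐉 [] x = x := fun x => rfl
  have hnode : ∀ i j : Fin 5, node i j = if j = i then (1 : ℝ) else 0 := fun i j => by
    rw [node, Pi.single_apply]
  rw [lor_smul_left, lor_smul_right, ← mul_assoc]
  fin_cases i <;> fin_cases j <;>
    simp [clusterWord, clusterWeight, -wordMap_nil, hnil, wordMap_zero_weight,
      wordMap_one_zero_weight, wordMap_four_one_zero_weight, h00, h02, h20, h22, lor_add_left,
      lor_add_right, lor_node_node, lor_node_weight, lor_weight_left, weight_zero_zero,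
      weight_zero_two, weight_two_zero, weight_two_two, hnode, j01, j10, j04, j40, j14, j41,
      isCoxeterGram_maxwellGram.diag] <;>
    linarith

theorem hasApollonianProperty_graphPacking : HasApollonianProperty 𝐉 (graphPacking 𝐉) := by
  have hJ := isCoxeterGram_maxwellGram
  intro n hn
  obtain ⟨L, i, hi, rfl⟩ := mem_graphPacking_iff.1 hn
  have hw : ∀ j, clusterWeight j = 0 ∨ clusterWeight j = 2 := by decide
  refine ⟨fun j => wordMap 𝐉 L (weightScale (clusterWeight j) •
    wordMap 𝐉 (clusterWord j) (weight 𝐉 (clusterWeight j))), ?_, fun j => ?_, ?_⟩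
  · obtain ⟨k, hk, h⟩ := isCluster_clusterWord
    exact ⟨k, hk, fun i j => by rw [hJ.lor_wordMap, h]⟩
  · exact wordMap_mem_graphPacking (smul_wordMap_mem (hw j) _) L
  · rcases hi with rfl | rfl
    · exact ⟨0, map_smul _ _ _⟩
    · exact ⟨4, map_smul _ _ _⟩

/-! ### The packing is crystallographic -/

theorem weylGroup_mem_hyp {D : Fin 5 → ℝ} (hD : IsChamberVector 𝐉 D)
    {γ : (Fin 5 → ℝ) ≃ₗ[ℝ] (Fin 5 → ℝ)} (hγ : γ ∈ weylGroup 𝐉) {x : Fin 5 → ℝ}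
    (hx : x ∈ hyp 𝐉 D) : γ x ∈ hyp 𝐉 D := by
  obtain ⟨L, hL⟩ := isCoxeterGram_maxwellGram.exists_word hγ
  obtain ⟨h1, h2⟩ := (mem_hyp_iff hD).1 hx
  rw [mem_hyp_iff hD, hL, isCoxeterGram_maxwellGram.lor_wordMap]
  exact ⟨h1, wordMap_three_pos L (h1 ▸ one_pos) h2⟩

theorem image_eq_of_forall_mem {V : Type*} [AddCommGroup V] [Module ℝ V]
    {Γ : Subgroup (V ≃ₗ[ℝ] V)} {A : Set V} (h : ∀ γ ∈ Γ, ∀ x ∈ A, γ x ∈ A) {γ : V ≃ₗ[ℝ] V}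
    (hγ : γ ∈ Γ) : γ '' A = A :=
  Set.Subset.antisymm (Set.image_subset_iff.2 (h γ hγ)) fun x hx =>
    ⟨γ⁻¹ x, h _ (inv_mem hγ) x hx, γ.apply_symm_apply x⟩

theorem weylGroup_mem_isometries {D : Fin 5 → ℝ} (hD : IsChamberVector 𝐉 D)
    {γ : (Fin 5 → ℝ) ≃ₗ[ℝ] (Fin 5 → ℝ)} (hγ : γ ∈ weylGroup 𝐉) : γ ∈ isometries 𝐉 D := by
  refine ⟨fun u v => ?_,
    image_eq_of_forall_mem (fun γ hγ x hx => weylGroup_mem_hyp hD hγ hx) hγ⟩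
  obtain ⟨L, hL⟩ := isCoxeterGram_maxwellGram.exists_word hγ
  rw [hL, hL, isCoxeterGram_maxwellGram.lor_wordMap]

theorem isGeometricallyFinite_weylGroup {D : Fin 5 → ℝ} (hD : IsChamberVector 𝐉 D) :
    IsGeometricallyFinite 𝐉 D (weylGroup 𝐉) := by
  have hJ := isCoxeterGram_maxwellGram
  refine ⟨Set.range node, Set.finite_range _, ?_, fun γ hγ h1 => ?_, fun x hx => ?_⟩
  · have h0 := lor_self_chamberPoint_pos
    have h1 : √(lor 𝐉 chamberPoint chamberPoint) * √(lor 𝐉 chamberPoint chamberPoint) =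
      lor 𝐉 chamberPoint chamberPoint := Real.mul_self_sqrt h0.le
    have h2 : 0 < √(lor 𝐉 chamberPoint chamberPoint) := Real.sqrt_pos.2 h0
    refine ⟨(√(lor 𝐉 chamberPoint chamberPoint))⁻¹ • chamberPoint,
      (mem_hyp_iff hD).2 ⟨?_, mul_pos (inv_pos.2 h2) (chamberPoint_pos 3)⟩, ?_⟩
    · rw [lor_smul_left, lor_smul_right]
      field_simp
      rw [pow_two, h1]
    · rintro _ ⟨i, rfl⟩
      rw [lor_smul_right]
      exact mul_pos (inv_pos.2 h2)
        (lt_of_lt_of_le (by norm_num) (half_le_lor_node_chamberPoint i))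
  · refine Set.disjoint_left.2 ?_
    rintro _ ⟨x, ⟨-, hx⟩, rfl⟩ ⟨-, hy⟩
    obtain ⟨L, hL⟩ := hJ.exists_word hγ
    have := hJ.wordMap_eq_one_of_chamber (L := L) (x := x) (fun k => (hx _ ⟨k, rfl⟩).le)
      fun k => by rw [← hL]; exact hy _ ⟨k, rfl⟩
    exact h1 (LinearEquiv.ext fun x => by rw [hL, this]; rfl)
  · obtain ⟨hx1, hx3⟩ := (mem_hyp_iff hD).1 hx
    obtain ⟨L, hL⟩ := exists_wordMap_mem_chamber (hx1 ▸ one_pos) hx3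
    obtain ⟨γ, hγ, h⟩ := hJ.exists_mem_weylGroup L
    exact ⟨γ, hγ, Set.forall_mem_range.2 fun i => by rw [h]; exact hL i⟩

/-- The basis `αᵢ / 4`, whose `ℤ[√3]`-lattice contains the weights. -/
def quarterBasis : Module.Basis (Fin 5) ℝ (Fin 5 → ℝ) :=
  Module.Basis.ofEquivFun (LinearEquiv.smulOfNeZero ℝ (Fin 5 → ℝ) 4 (by norm_num))

theorem mem_latticeOver_quarterBasis {R : Subring ℝ} {v : Fin 5 → ℝ} :
    v ∈ latticeOver R quarterBasis ↔ ∀ i, 4 * v i ∈ R := Iff.rfl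

theorem maxwellGram_mem (i j : Fin 5) : 𝐉 i j ∈ Subring.closure {√3} := by
  rcases eq_or_ne i j with rfl | h
  · rw [isCoxeterGram_maxwellGram.diag]
    exact_mod_cast intCast_mem (Subring.closure {√3}) (-2)
  · rcases isCoxeterGram_maxwellGram.off i j h with h | h | h <;> rw [h]
    · exact zero_mem _
    · exact one_mem _
    · exact Subring.subset_closure rfl

theorem weylGroup_mem_latticeOver {γ : (Fin 5 → ℝ) ≃ₗ[ℝ] (Fin 5 → ℝ)} (hγ : γ ∈ weylGroup 𝐉)
    {x : Fin 5 → ℝ} (hx : x ∈ latticeOver (Subring.closure {√3}) quarterBasis) :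
    γ x ∈ latticeOver (Subring.closure {√3}) quarterBasis := by
  obtain ⟨L, hL⟩ := isCoxeterGram_maxwellGram.exists_word hγ
  rw [hL]
  clear hL
  induction L with
  | nil => exact hx
  | cons i L ih =>
    rw [wordMap_cons, Module.End.mul_apply]
    rw [mem_latticeOver_quarterBasis] at ih ⊢
    intro k
    rw [refl_apply, Pi.add_apply, mul_add]
    refine add_mem (ih k) ?_
    rw [Pi.smul_apply, smul_eq_mul, ← mul_assoc]
    refine mul_mem ?_ ?_
    · rw [lor_node_left, Matrix.mulVec, dotProduct, Finset.mul_sum]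
      refine sum_mem fun j _ => ?_
      rw [mul_left_comm]
      exact mul_mem (maxwellGram_mem i j) (ih j)
    · rw [node, Pi.single_apply]
      split_ifs
      · exact one_mem _
      · exact zero_mem _

theorem weight_mem_latticeOver (i : Fin 5) :
    weight 𝐉 i ∈ latticeOver (Subring.closure {√3}) quarterBasis := by
  rw [mem_latticeOver_quarterBasis]
  have key : ∀ a b : ℤ, (a + b * √3 : ℝ) ∈ Subring.closure {√3} := fun a b =>
    add_mem (intCast_mem _ a) (mul_mem (intCast_mem _ b) (Subring.subset_closure rfl))
  suffices h : ∀ j, ∃ a b : ℤ, 4 * weight 𝐉 i j = a + b * √3 by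
    intro j
    obtain ⟨a, b, h⟩ := h j
    rw [h]; exact key a b
  -- Four times the inverse Gram matrix is `A + √3 B`.
  let A : Matrix (Fin 5) (Fin 5) ℤ :=
    !![-2, 0, -1, -2, 3; 0, 0, -2, -4, 6; -1, -2, -2, 2, -1; -2, -4, 2, 8, -8; 3, 6, -1, -8, 10]
  let B : Matrix (Fin 5) (Fin 5) ℤ :=
    !![0, 0, 1, 2, -1; 0, 0, 2, 4, -2; 1, 2, 1, 0, 2; 2, 4, 0, -4, 6; -1, -2, 2, 6, -5]
  intro j
  refine ⟨A i j, B i j, ?_⟩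
  rw [weight_eq]
  fin_cases i <;> fin_cases j <;> simp [weightMatrix, A, B] <;> ring

theorem isCrystallographic_graphPacking {D : Fin 5 → ℝ} (hD : IsChamberVector 𝐉 D) :
    IsCrystallographic 𝐉 D (Subring.closure {√3}) (graphPacking 𝐉) := by
  refine ⟨quarterBasis, weylGroup 𝐉, {weight 𝐉 0, weight 𝐉 2}, fun γ hγ =>
    ⟨weylGroup_mem_isometries hD hγ,
      image_eq_of_forall_mem (fun γ hγ x hx => weylGroup_mem_latticeOver hγ hx) hγ⟩,
    isGeometricallyFinite_weylGroup hD, Set.toFinite _, ?_, ?_, ?_⟩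
  · rintro _ (rfl | rfl) <;> exact weight_mem_latticeOver _
  · rintro _ (rfl | rfl)
    · exact (lor_weight_neg_iff 0).2 (.inl rfl)
    · exact (lor_weight_neg_iff 2).2 (.inr rfl)
  · ext x
    constructor
    · rintro ⟨γ, hγ, i, hi, rfl⟩
      rcases (lor_weight_neg_iff i).1 hi with rfl | rfl
      · exact ⟨γ, hγ, _, .inl rfl, rfl⟩
      · exact ⟨γ, hγ, _, .inr rfl, rfl⟩
    · rintro ⟨γ, hγ, _, rfl | rfl, rfl⟩
      · exact ⟨γ, hγ, 0, (lor_weight_neg_iff 0).2 (.inl rfl), rfl⟩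
      · exact ⟨γ, hγ, 2, (lor_weight_neg_iff 2).2 (.inr rfl), rfl⟩

theorem isApollonian_graphPacking {D : Fin 5 → ℝ} (hD : IsChamberVector 𝐉 D) :
    IsApollonian 𝐉 D (Subring.closure {√3}) (graphPacking 𝐉) :=
  ⟨isPacking_graphPacking hD, isCrystallographic_graphPacking hD, isMaximal_graphPacking hD,
    hasApollonianProperty_graphPacking⟩

/-! ### The additive group generated by the packing -/

/-- The group generated by the packing contains two incommensurable multiples of every root in the
orbit of the last node. -/
theorem smul_wordMap_node_mem_span (L : List (Fin 5)) :
    weightScale 0 • wordMap 𝐉 L (node 4) ∈ Submodule.span ℤ (graphPacking 𝐉) ∧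
    √3 • weightScale 0 • wordMap 𝐉 L (node 4) ∈ Submodule.span ℤ (graphPacking 𝐉) := by
  have hmem : ∀ M, weightScale 0 • wordMap 𝐉 L (wordMap 𝐉 M (weight 𝐉 0)) ∈
      Submodule.span ℤ (graphPacking 𝐉) := fun M => by
    rw [← Module.End.mul_apply, ← wordMap_append]
    exact Submodule.subset_span (smul_wordMap_mem (.inl rfl) _)
  have w2 : wordMap 𝐉 [2, 1, 0] (weight 𝐉 0) = weight 𝐉 0 + node 0 + node 1 + node 2 := by
    rw [wordMap_cons, Module.End.mul_apply, wordMap_one_zero_weight, refl_apply, lor_add_right,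
      lor_add_right, lor_node_weight, lor_node_node, lor_node_node]
    simp [maxwellGram]
  have w3 : wordMap 𝐉 [3, 2, 1, 0] (weight 𝐉 0) =
      weight 𝐉 0 + node 0 + node 1 + node 2 + node 3 := by
    rw [wordMap_cons, Module.End.mul_apply, w2, refl_apply, lor_add_right, lor_add_right,
      lor_add_right, lor_node_weight, lor_node_node, lor_node_node, lor_node_node]
    simp [maxwellGram]
  have w4 : wordMap 𝐉 [4, 3, 2, 1, 0] (weight 𝐉 0) =
      weight 𝐉 0 + node 0 + node 1 + node 2 + node 3 + (1 + √3) • node 4 := by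
    rw [wordMap_cons, Module.End.mul_apply, w3, refl_apply, lor_add_right, lor_add_right,
      lor_add_right, lor_add_right, lor_node_weight, lor_node_node, lor_node_node, lor_node_node,
      lor_node_node]
    simp [maxwellGram]
  -- The last letter `4` adds `α₄` in the first difference. In the second it adds `(1 + √3) α₄`,
  -- owing to the edge `√3` between nodes `3` and `4`.
  have m1 := sub_mem (hmem [4, 1, 0]) (hmem [1, 0])
  have m2 := sub_mem (hmem [4, 3, 2, 1, 0]) (hmem [3, 2, 1, 0])
  rw [wordMap_four_one_zero_weight, wordMap_one_zero_weight, ← smul_sub, ← map_sub,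
    add_sub_cancel_left] at m1
  rw [w4, w3, ← smul_sub, ← map_sub, add_sub_cancel_left, map_smul] at m2
  refine ⟨m1, ?_⟩
  convert sub_mem m2 m1 using 1
  module

theorem eq_zero_of_int_of_sqrt_three_mul_int {x : ℝ} {k l : ℤ} (hk : x = k) (hl : √3 * x = l) :
    x = 0 := by
  by_contra hx
  have hirr : Irrational √3 := by
    simpa using (show Nat.Prime 3 by norm_num).irrational_sqrt
  refine hirr ⟨(l : ℚ) / k, ?_⟩
  push_cast
  rw [← hk, ← hl]
  field_simp

/-- In a lattice basis a multiple of `α₄` and its `√3`-fold would both have integer coordinates, so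
all of them vanish. -/
theorem not_isLatticeType_graphPacking : ¬ IsLatticeType (graphPacking 𝐉) := by
  rintro ⟨b, hb⟩
  obtain ⟨h1, h2⟩ := smul_wordMap_node_mem_span []
  rw [hb, b.mem_span_iff_repr_mem ℤ] at h1 h2
  have h0 : weightScale 0 • wordMap 𝐉 [] (node 4) = 0 := by
    refine b.ext_elem fun i => ?_
    obtain ⟨k, hk⟩ := h1 i
    obtain ⟨l, hl⟩ := h2 i
    rw [map_smul, Finsupp.smul_apply, smul_eq_mul] at hl
    rw [map_zero]
    exact eq_zero_of_int_of_sqrt_three_mul_int hk.symm hl.symm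
  have := congrFun h0 4
  simp [node, (weightScale_pos (.inl rfl)).ne'] at this

theorem not_integral_curvatures {D E : Fin 5 → ℝ} (hE : E ∈ lightCone 𝐉 D) :
    ¬ ∀ n ∈ graphPacking 𝐉, ∃ k : ℤ, curvature 𝐉 E n = k := by
  intro h
  have hspan : ∀ v ∈ Submodule.span ℤ (graphPacking 𝐉), ∃ k : ℤ, lor 𝐉 v E = k := by
    intro v hv
    induction hv using Submodule.span_induction with
    | mem n hn =>
      obtain ⟨k, hk⟩ := h n hn
      rw [curvature, len, lor_self_of_mem hn, neg_neg, Real.sqrt_one, div_one] at hk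
      exact ⟨k, hk⟩
    | zero => exact ⟨0, by simp [lor_zero_left]⟩
    | add u v _ _ hu hv =>
      obtain ⟨k, hk⟩ := hu
      obtain ⟨l, hl⟩ := hv
      exact ⟨k + l, by rw [lor_add_left, hk, hl]; push_cast; rfl⟩
    | smul a v _ hv =>
      obtain ⟨k, hk⟩ := hv
      exact ⟨a * k, by rw [← Int.cast_smul_eq_zsmul ℝ, lor_smul_left, hk]; push_cast; rfl⟩
  have hzero : ∀ L, lor 𝐉 (wordMap 𝐉 L (node 4)) E = 0 := by
    intro L
    obtain ⟨h1, h2⟩ := smul_wordMap_node_mem_span L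
    obtain ⟨k, hk⟩ := hspan _ h1
    obtain ⟨l, hl⟩ := hspan _ h2
    rw [lor_smul_left] at hl
    have := eq_zero_of_int_of_sqrt_three_mul_int hk hl
    rw [lor_smul_left] at this
    exact (mul_eq_zero.1 this).resolve_left (weightScale_pos (.inl rfl)).ne'
  -- These words run along the edges from node `4` to the others, so orthogonality to the five roots
  -- propagates to every node; then `E · D = 0`.
  have e4 := hzero []
  have e3 := hzero [3]
  have e2 := hzero [2, 3]
  have e1 := hzero [1]
  have e0 := hzero [0, 1]
  have h3 : √(3 : ℝ) ≠ 0 := by positivity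
  simp only [wordMap_cons, wordMap_nil, Module.End.mul_apply, Module.End.one_apply, refl_apply,
    lor_add_left, lor_smul_left, lor_add_right, lor_smul_right, lor_node_node] at e4 e3 e2 e1 e0
  have j01 : 𝐉 0 1 = 1 := rfl
  have j04 : 𝐉 0 4 = 0 := rfl
  have j14 : 𝐉 1 4 = 1 := rfl
  have j23 : 𝐉 2 3 = 1 := rfl
  have j24 : 𝐉 2 4 = 0 := rfl
  have j34 : 𝐉 3 4 = √3 := rfl
  simp only [j01, j04, j14, j23, j24, j34, e4, zero_add, mul_one, one_mul, mul_eq_zero, h3,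
    false_or] at e3 e2 e1 e0
  rw [e3, mul_zero, zero_add, mul_eq_zero, or_iff_right h3] at e2
  rw [e1, zero_add] at e0
  have hpos := hE.2
  rw [lor_maxwell_comm, lor_eq_sum_left, Fin.sum_univ_five, e0, e1, e2, e3, e4] at hpos
  simp at hpos

/-! ### The packing is not the Soddy packing -/

section Soddy

variable {k : ℝ} {c : Fin 5 → Fin 5 → ℝ}

theorem sum_mul_cluster (g : Fin 5 → ℝ) (j : Fin 5) :
    ∑ i, g i * (if i = j then -k else k) = k * (∑ i, g i - 2 * g j) := by
  fin_cases j <;> simp [Fin.sum_univ_five] <;> ring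

theorem lor_sum_left {ι : Type*} (s : Finset ι) (g : ι → ℝ) (f : ι → Fin 5 → ℝ) (x : Fin 5 → ℝ) :
    lor 𝐉 (∑ i ∈ s, g i • f i) x = ∑ i ∈ s, g i * lor 𝐉 (f i) x := by
  classical
  induction s using Finset.induction_on with
  | empty => simp [lor_zero_left]
  | insert a s ha ih =>
    rw [Finset.sum_insert ha, Finset.sum_insert ha, lor_add_left, lor_smul_left, ih]

/-- A relation forces every coefficient to be half of their sum; with five of them the sum is `5/2`
of itself, hence zero. -/
theorem linearIndependent_cluster (hk : 0 < k)
    (hc : ∀ i j, lor 𝐉 (c i) (c j) = if i = j then -k else k) : LinearIndependent ℝ c := by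
  refine Fintype.linearIndependent_iff.2 fun g hg => ?_
  have h : ∀ j, g j = (∑ i, g i) / 2 := fun j => by
    have h1 := lor_sum_left Finset.univ g c (c j)
    simp_rw [hc] at h1
    rw [hg, lor_zero_left, sum_mul_cluster, eq_comm, mul_eq_zero, or_iff_right hk.ne'] at h1
    linarith
  have h0 : ∑ i, g i = 0 := by
    have : ∑ i, g i = ∑ _i : Fin 5, (∑ i, g i) / 2 := Finset.sum_congr rfl fun j _ => h j
    rw [Finset.sum_const, Finset.card_univ, Fintype.card_fin, nsmul_eq_mul] at this
    push_cast at this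
    linarith
  intro j
  rw [h j, h0, zero_div]

theorem eq_zero_of_orthogonal_cluster (hk : 0 < k)
    (hc : ∀ i j, lor 𝐉 (c i) (c j) = if i = j then -k else k) {x : Fin 5 → ℝ}
    (hx : ∀ j, lor 𝐉 x (c j) = 0) : x = 0 := by
  have hspan : Submodule.span ℝ (Set.range c) = ⊤ :=
    (linearIndependent_cluster hk hc).span_eq_top_of_card_eq_finrank (by simp)
  have h : ∀ y, lor 𝐉 x y = 0 := by
    intro y
    have hy : y ∈ Submodule.span ℝ (Set.range c) := hspan ▸ Submodule.mem_top
    induction hy using Submodule.span_induction with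
    | mem y hy => obtain ⟨j, rfl⟩ := hy; exact hx j
    | zero => exact lor_zero_right _ _
    | add y z _ _ hy hz => rw [lor_add_right, hy, hz, add_zero]
    | smul a y _ hy => rw [lor_smul_right, hy, mul_zero]
  ext i
  rw [← lor_weight_left i x, lor_maxwell_comm, h, Pi.zero_apply]

/-- There are just two spheres that are tangent to four given members of a cluster. -/
theorem eq_or_eq_of_tangent (hk : 0 < k)
    (hc : ∀ i j, lor 𝐉 (c i) (c j) = if i = j then -k else k) {i : Fin 5} {v : Fin 5 → ℝ}
    (hv : lor 𝐉 v v = -k) (hvc : ∀ j, j ≠ i → lor 𝐉 v (c j) = k) :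
    v = c i ∨ v = ∑ j, c j - (2 : ℤ) • c i := by
  have hs : ∀ j, lor 𝐉 (∑ l, c l) (c j) = 3 * k := fun j => by
    have h1 := lor_sum_left Finset.univ (fun _ => 1) c (c j)
    simp_rw [hc] at h1
    rw [sum_mul_cluster] at h1
    simp only [one_smul] at h1
    rw [h1, Finset.sum_const, Finset.card_univ, Fintype.card_fin]
    norm_num
    ring
  -- Since `(∑ c) · cⱼ = 3k` for all `j`, `t` is orthogonal to the four remaining spheres. So `v =
  -- cᵢ + a t`, and the norm of `v` gives `a (1 - a) = 0`.
  set t := ∑ l, c l - (3 : ℝ) • c i with ht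
  have htj : ∀ j, lor 𝐉 t (c j) = if i = j then 6 * k else 0 := fun j => by
    rw [ht, lor_sub_left, lor_smul_left, hs, hc]
    split_ifs <;> ring
  have hti : lor 𝐉 t (c i) = 6 * k := by rw [htj, if_pos rfl]
  have htt : lor 𝐉 t t = -12 * k := by
    have h1 := lor_sum_left Finset.univ (fun _ => 1) c t
    simp only [one_smul, one_mul, lor_maxwell_comm _ t, htj, Finset.sum_ite_eq,
      Finset.mem_univ, if_true] at h1
    conv_lhs => rw [ht, lor_sub_left, lor_smul_left, lor_maxwell_comm (c i), hti,
      lor_maxwell_comm _ t, h1]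
    ring
  obtain ⟨a, ha⟩ : ∃ a, lor 𝐉 v (c i) = -k + a * (6 * k) :=
    ⟨(lor 𝐉 v (c i) + k) / (6 * k), by field_simp; ring⟩
  have hva : v = c i + a • t := by
    rw [← sub_eq_zero]
    refine eq_zero_of_orthogonal_cluster hk hc fun j => ?_
    rw [lor_sub_left, lor_add_left, lor_smul_left, htj, hc]
    rcases eq_or_ne i j with rfl | hij
    · rw [ha, if_pos rfl, if_pos rfl]; ring
    · rw [hvc j hij.symm, if_neg hij, if_neg hij]; ring
  rw [hva] at hv
  simp only [lor_add_left, lor_add_right, lor_smul_left, lor_smul_right, hc, if_true, hti, htt,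
    lor_maxwell_comm (c i) t] at hv
  have h1 : (12 * k) * (a * (1 - a)) = 0 := by linarith
  rcases mul_eq_zero.1 ((mul_eq_zero.1 h1).resolve_left (by positivity)) with h | h
  · left; rw [hva, h, zero_smul, add_zero]
  · right
    rw [hva, show a = 1 by linarith, ht]
    module

/-- The only exchange is `cᵢ ↦ ∑ c - 2 cᵢ`, which has integer coefficients. -/
theorem ReachableCluster.mem_span {e : Fin 5 → Fin 5 → ℝ} (he : IsCluster 𝐉 e)
    (h : ReachableCluster 𝐉 e c) :
    IsCluster 𝐉 c ∧ ∀ i, c i ∈ Submodule.span ℤ (Set.range e) := by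
  induction h with
  | base => exact ⟨he, fun i => Submodule.subset_span ⟨i, rfl⟩⟩
  | step c i v _ hv ih =>
    refine ⟨hv, fun j => ?_⟩
    obtain ⟨⟨k, hk, hc⟩, hmem⟩ := ih
    obtain ⟨k', -, hc'⟩ := hv
    obtain ⟨l, hl⟩ := exists_ne i
    have hkk : k = k' := by
      have h1 := hc' l l
      rw [Function.update_of_ne hl, hc, if_pos rfl, if_pos rfl] at h1
      exact neg_inj.1 h1
    subst hkk
    rcases eq_or_ne j i with rfl | hj
    · rw [Function.update_self]
      have h1 := hc' j j
      rw [Function.update_self, if_pos rfl] at h1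
      rcases eq_or_eq_of_tangent hk hc h1 fun l hl => by
        have h2 := hc' j l
        rwa [Function.update_self, Function.update_of_ne hl, if_neg hl.symm] at h2 with h | h
      · rw [h]; exact hmem j
      · rw [h]
        exact sub_mem (sum_mem fun l _ => hmem l) (Submodule.smul_mem _ _ (hmem j))
    · rw [Function.update_of_ne hj]; exact hmem j

theorem IsSoddyPacking.isLatticeType {P : Set (Fin 5 → ℝ)} (hP : IsSoddyPacking 𝐉 P) :
    IsLatticeType P := by
  obtain ⟨e, he, rfl⟩ := hP
  obtain ⟨k, hk, hc⟩ := id he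
  refine ⟨basisOfLinearIndependentOfCardEqFinrank (linearIndependent_cluster hk hc) (by simp), ?_⟩
  rw [coe_basisOfLinearIndependentOfCardEqFinrank]
  refine le_antisymm (Submodule.span_le.2 ?_) (Submodule.span_le.2 ?_)
  · rintro _ ⟨c, i, h, rfl⟩
    exact (h.mem_span he).2 i
  · rintro _ ⟨i, rfl⟩
    exact Submodule.subset_span ⟨e, i, .base, rfl⟩

end Soddy

/-! ### The signature -/

/-- An orthogonal basis, with the timelike vector last. -/
def orthogonalFamily : Fin 5 → Fin 5 → ℝ :=
  ![![1, 0, 0, 0, 0], ![0, 0, 1, 0, 0], ![0, 0, 0, 0, 1], ![1, 2, 1, 0, 1],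
    -- A common zero of the forms in `spacePart`, of norm `8 + 4√3 = 8 / (√3 - 1)²`.
    ![1 + √3, 2 * (1 + √3), 2 + √3, 2, 1 + 2 * √3]]

/-- The factors that normalize `orthogonalFamily`. -/
def orthogonalScale : Fin 5 → ℝ :=
  ![(√2)⁻¹, (√2)⁻¹, (√2)⁻¹, (√2)⁻¹, (√3 - 1) * (√2)⁻¹ / 2]

theorem lor_orthogonalFamily (i j : Fin 5) :
    lor 𝐉 (orthogonalScale i • orthogonalFamily i) (orthogonalScale j • orthogonalFamily j) =
      if i = j then (if i = 4 then 1 else -1) else 0 := by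
  have h3 := sqrt_three_mul_self
  have h2 : (√2)⁻¹ * (√2)⁻¹ = (1 / 2 : ℝ) := by
    rw [← mul_inv, Real.mul_self_sqrt (by norm_num)]; norm_num
  rw [lor_smul_left, lor_smul_right, ← mul_assoc]
  by_cases hij : i = j
  · subst hij
    rw [if_pos rfl, lor_eq_five]
    fin_cases i <;> simp [orthogonalFamily, orthogonalScale, -mul_inv_rev] at h2 ⊢
    · linarith
    · linarith
    · linarith
    · linarith
    · linear_combination ((√3 - 1) ^ 2 * (√3 ^ 2 + √3 - 1)) * h2 +
        (1 / 2 * (√3 ^ 2 - √3 + 1)) * h3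
  · rw [if_neg hij, mul_eq_zero]
    right
    rw [lor_eq_five]
    fin_cases i <;> fin_cases j <;> simp [orthogonalFamily] at hij ⊢ <;> linarith

theorem isLorentzian_maxwellGram : IsLorentzian 𝐉 := by
  have hli : LinearIndependent ℝ fun i => orthogonalScale i • orthogonalFamily i := by
    refine Fintype.linearIndependent_iff.2 fun g hg j => ?_
    have h1 := lor_sum_left Finset.univ g (fun i => orthogonalScale i • orthogonalFamily i)
      (orthogonalScale j • orthogonalFamily j)
    rw [hg, lor_zero_left] at h1
    simp only [lor_orthogonalFamily, mul_ite, mul_zero, Finset.sum_ite_eq', Finset.mem_univ,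
      if_true] at h1
    split_ifs at h1 <;> linarith
  refine ⟨isCoxeterGram_maxwellGram.symm,
    basisOfLinearIndependentOfCardEqFinrank hli (by simp), 4, fun i j => ?_⟩
  rw [coe_basisOfLinearIndependentOfCardEqFinrank]
  exact lor_orthogonalFamily i j

end SpherePacking

end

theorem mainTheorem7 :
    SpherePacking.IsLorentzian SpherePacking.maxwellGram ∧
    (∃ D, SpherePacking.IsChamberVector SpherePacking.maxwellGram D) ∧
    ∀ D, SpherePacking.IsChamberVector SpherePacking.maxwellGram D →
      SpherePacking.IsApollonian SpherePacking.maxwellGram D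
        (Subring.closure {Real.sqrt 3})
        (SpherePacking.graphPacking SpherePacking.maxwellGram) ∧
      ¬ SpherePacking.IsSoddyPacking SpherePacking.maxwellGram
        (SpherePacking.graphPacking SpherePacking.maxwellGram) ∧
      ¬ SpherePacking.IsLatticeType
        (SpherePacking.graphPacking SpherePacking.maxwellGram) ∧
      ¬ ∃ E ∈ SpherePacking.lightCone SpherePacking.maxwellGram D,
        ∀ n ∈ SpherePacking.graphPacking SpherePacking.maxwellGram,
          ∃ k : ℤ, SpherePacking.curvature SpherePacking.maxwellGram E n = k :=
  ⟨SpherePacking.isLorentzian_maxwellGram,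
    ⟨_, SpherePacking.isChamberVector_chamberPoint⟩, fun _ hD =>
    ⟨SpherePacking.isApollonian_graphPacking hD,
      fun h => SpherePacking.not_isLatticeType_graphPacking h.isLatticeType,
      SpherePacking.not_isLatticeType_graphPacking,
      fun ⟨_, hE, h⟩ => SpherePacking.not_integral_curvatures hE h⟩⟩
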